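/- Let $Y$ be a finite partially ordered set (poset). Let $Y_0 \subseteq Y$ be a subset such that for any two distinct elements $y \neq y'$ of $Y_0$ the up-sets $\{z \in Y : z \geq y\}$ and $\{z \in Y : z \geq y'\}$ are disjoint and the down-sets $\{z \in Y : z \leq y\}$ and $\{z \in Y : z \leq y'\}$ are disjoint. Define two partial orders $\leq_+^{Y_0}$ and $\leq_-^{Y_0}$ on $Y \cup \{*\}$, where $* \notin Y$, by extending the order of $Y$ according to $$* <_+^{Y_0} y \iff \exists\, y_0 \in Y_0 \text{ with } y_0 \leq y, \qquad\quad y <_-^{Y_0} * \iff \exists\, y_0 \in Y_0 \text{ with } y \leq y_0 \qquad (y \in Y),$$ with no other relations. Then the posets $(Y \cup \{*\}, \leq_+^{Y_0})$ and $(Y \cup \{*\}, \leq_-^{Y_0})$ are universally derived equivalent; that is, for every abelian category $\mathcal{A}$, the (unbounded) derived categories of the abelian categories of functors from these two posets (viewed as categories) to $\mathcal{A}$ are equivalent as triangulated categories. -/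

import Mathlib

open CategoryTheory

universe v u w₁ w₂ a b

/-- Two posets `X` and `Y` are universally derived equivalent if for every abelian category `A`
the (unbounded) derived categories of the categories of diagrams `X ⥤ A` and `Y ⥤ A` are
equivalent as triangulated categories: there is a functor commuting with the shifts and
preserving distinguished triangles which is an equivalence of categories.

Posets are viewed as categories with exactly one morphism `x ⟶ x'` when `x ≤ x'`. The instances
`HasDerivedCategory` are choices of a localization with respect to quasi-isomorphisms (a derived
category with morphism types in a given universe); all choices are allowed. -/
def UniversallyDerivedEquivalent (X : Type a) (Y : Type b) [PartialOrder X] [PartialOrder Y] :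
    Prop :=
  ∀ (A : Type u) [Category.{v} A] [Abelian A]
    [HasDerivedCategory.{w₁} (X ⥤ A)] [HasDerivedCategory.{w₂} (Y ⥤ A)],
    ∃ (F : DerivedCategory (X ⥤ A) ⥤ DerivedCategory (Y ⥤ A)) (_ : F.CommShift ℤ),
      F.IsTriangulated ∧ F.IsEquivalence

/-- The set `Y ∪ {*}`, to be ordered with `*` as a source below the elements of `Y₀`. -/
inductive SourceExtension {Y : Type a} (Y₀ : Set Y) : Type a
  | star : SourceExtension Y₀
  | of (y : Y) : SourceExtension Y₀

/-- The set `Y ∪ {*}`, to be ordered with `*` as a sink above the elements of `Y₀`. -/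
inductive SinkExtension {Y : Type a} (Y₀ : Set Y) : Type a
  | star : SinkExtension Y₀
  | of (y : Y) : SinkExtension Y₀

namespace SourceExtension

/-- The relation `≤₊`: it extends the order of `Y`, and `* ≤₊ y` if and only if `y₀ ≤ y` for
some `y₀ ∈ Y₀`; no `y ∈ Y` is below `*`. -/
def le {Y : Type a} [PartialOrder Y] {Y₀ : Set Y} :
    SourceExtension Y₀ → SourceExtension Y₀ → Prop
  | star, star => True
  | star, of y => ∃ y₀ ∈ Y₀, y₀ ≤ y
  | of _, star => False
  | of y, of y' => y ≤ y'

instance {Y : Type a} [PartialOrder Y] (Y₀ : Set Y) : PartialOrder (SourceExtension Y₀) where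
  le := le
  le_refl p := by cases p <;> simp [le]
  le_trans p q r hpq hqr := by
    cases p <;> cases q <;> cases r <;> simp only [le] at hpq hqr ⊢
    · exact hqr
    · obtain ⟨y₀, h₀, h⟩ := hpq
      exact ⟨y₀, h₀, h.trans hqr⟩
    · exact hpq.trans hqr
  le_antisymm p q hpq hqp := by
    cases p <;> cases q <;> simp only [le] at hpq hqp
    · rfl
    · exact congrArg of (le_antisymm hpq hqp)

end SourceExtension

namespace SinkExtension

/-- The relation `≤₋`: it extends the order of `Y`, and `y ≤₋ *` if and only if `y ≤ y₀` for
some `y₀ ∈ Y₀`; no `y ∈ Y` is above `*`. -/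
def le {Y : Type a} [PartialOrder Y] {Y₀ : Set Y} :
    SinkExtension Y₀ → SinkExtension Y₀ → Prop
  | star, star => True
  | star, of _ => False
  | of y, star => ∃ y₀ ∈ Y₀, y ≤ y₀
  | of y, of y' => y ≤ y'

instance {Y : Type a} [PartialOrder Y] (Y₀ : Set Y) : PartialOrder (SinkExtension Y₀) where
  le := le
  le_refl p := by cases p <;> simp [le]
  le_trans p q r hpq hqr := by
    cases p <;> cases q <;> cases r <;> simp only [le] at hpq hqr ⊢
    · exact hpq
    · obtain ⟨y₀, h₀, h⟩ := hqr
      exact ⟨y₀, h₀, hpq.trans h⟩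
    · exact hpq.trans hqr
  le_antisymm p q hpq hqp := by
    cases p <;> cases q <;> simp only [le] at hpq hqp
    · rfl
    · exact congrArg of (le_antisymm hpq hqp)

end SinkExtension

/-! A diagram on `Y ∪ {*}` is glued from its value X(*) at `*` and its restriction X|Y, and the two
orders differ only in the gluing datum. When `*` is a source, the datum is a map from X(*) to the
right Kan extension of X|Y at `*`; since the up-sets of the elements y₀ of Y₀ are disjoint, this is
the product of the X(y₀). When `*` is a sink, it is a map to X(*) from the left Kan extension at
`*`; since the down-sets are disjoint, this is the coproduct of the X(y₀). As Y₀ is finite and the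
coefficients are abelian, product and coproduct are the same exact functor. In the derived category,
a map from X(*) to this sum can thus be traded for the map from the sum to its cone, with no loss of
information.

Cones are not functorial in a triangulated category, so the construction passes through arrows of
diagrams. An exact functor `E` sends X to the arrow from X(*), placed at `*`, to the left Kan
extension of X|Y (`starToExtLeft`). The cone functor `L` is the left adjoint of sending an object N
to the arrow 0 ⟶ N (`exists_leftAdjoint_of_kernel`).

That F = `E ⋙ L` is an equivalence is formal (`exists_triangulated_equivalence_of_gluing`): F sends
right Kan extensions to extensions by zero, and objects concentrated at `*` to shifts of such
objects. Adjunctions compare the morphisms into these two kinds of objects, `BijectiveOnHomsTo.obj₂`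
passes to all targets through triangles, and the images of the two kinds generate the other side by
extensions. Every functor is exact before deriving, so unbounded complexes cause no difficulty. -/

open Limits

open Pretriangulated

/-! ### Exact functors, their adjunctions and vanishing criteria on derived categories. -/

section DerivedFunctors

variable {C D E : Type*} [Category* C] [Abelian C] [HasDerivedCategory C]
  [Category* D] [Abelian D] [HasDerivedCategory D]
  [Category* E] [Abelian E] [HasDerivedCategory E]

/-- The adjunction between categories of complexes induced by an adjunction between additive
functors. -/
def CategoryTheory.Adjunction.mapCochainComplex {F : C ⥤ D} {G : D ⥤ C} (adj : F ⊣ G)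
    [F.Additive] [G.Additive] :
    F.mapHomologicalComplex (ComplexShape.up ℤ) ⊣ G.mapHomologicalComplex (ComplexShape.up ℤ) :=
  Adjunction.mkOfUnitCounit
    { unit :=
        { app := fun K =>
            { f := fun n => adj.unit.app (K.X n)
              comm' := fun i j _ => (adj.unit.naturality (K.d i j)).symm }
          naturality := fun _ _ f => by
            ext n
            exact adj.unit.naturality (f.f n) }
      counit :=
        { app := fun K =>
            { f := fun n => adj.counit.app (K.X n)
              comm' := fun i j _ => (adj.counit.naturality (K.d i j)).symm }
          naturality := fun _ _ f => by
            ext n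
            exact adj.counit.naturality (f.f n) }
      left_triangle := by
        ext K n
        exact (congrArg (F.map (adj.unit.app (K.X n)) ≫ ·) (Category.id_comp _)).trans
          (adj.left_triangle_components (K.X n))
      right_triangle := by
        ext K n
        exact (congrArg (adj.unit.app (G.obj (K.X n)) ≫ ·) (Category.id_comp _)).trans
          (adj.right_triangle_components (K.X n)) }

variable {F F' : C ⥤ D} [F.Additive] [PreservesFiniteLimits F] [PreservesFiniteColimits F]
  [F'.Additive] [PreservesFiniteLimits F'] [PreservesFiniteColimits F']
  {G : D ⥤ C} [G.Additive] [PreservesFiniteLimits G] [PreservesFiniteColimits G]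
  {H : D ⥤ E} [H.Additive] [PreservesFiniteLimits H] [PreservesFiniteColimits H]
  {K : C ⥤ E} [K.Additive] [PreservesFiniteLimits K] [PreservesFiniteColimits K]

noncomputable instance (F : C ⥤ D) [F.Additive] [PreservesFiniteLimits F]
    [PreservesFiniteColimits F] :
    CatCommSq (F.mapHomologicalComplex (ComplexShape.up ℤ)) DerivedCategory.Q DerivedCategory.Q
      F.mapDerivedCategory where
  iso := F.mapDerivedCategoryFactors.symm

/-- The adjunction between derived categories induced by an adjunction between exact functors. -/
noncomputable def CategoryTheory.Adjunction.mapDerivedCategory (adj : F ⊣ G) :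
    F.mapDerivedCategory ⊣ G.mapDerivedCategory :=
  adj.mapCochainComplex.localization DerivedCategory.Q
    (HomologicalComplex.quasiIso C (ComplexShape.up ℤ)) DerivedCategory.Q
    (HomologicalComplex.quasiIso D (ComplexShape.up ℤ)) _ _

/-- Exact functors related by an isomorphism `F ⋙ H ≅ K` induce functors on derived categories
related by an isomorphism. -/
noncomputable def mapDerivedCategoryCompIso (e : F ⋙ H ≅ K) :
    F.mapDerivedCategory ⋙ H.mapDerivedCategory ≅ K.mapDerivedCategory :=
  letI : Localization.Lifting DerivedCategory.Q
      (HomologicalComplex.quasiIso C (ComplexShape.up ℤ))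
      (F.mapHomologicalComplex _ ⋙ H.mapHomologicalComplex _ ⋙ DerivedCategory.Q)
      (F.mapDerivedCategory ⋙ H.mapDerivedCategory) :=
    ⟨(Functor.associator _ _ _).symm ≪≫
      Functor.isoWhiskerRight F.mapDerivedCategoryFactors _ ≪≫ Functor.associator _ _ _ ≪≫
      Functor.isoWhiskerLeft _ H.mapDerivedCategoryFactors⟩
  Localization.liftNatIso DerivedCategory.Q
    (HomologicalComplex.quasiIso C (ComplexShape.up ℤ))
    (F.mapHomologicalComplex _ ⋙ H.mapHomologicalComplex _ ⋙ DerivedCategory.Q)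
    (K.mapHomologicalComplex _ ⋙ DerivedCategory.Q) _ _
    (Functor.isoWhiskerRight (Functor.mapHomologicalComplexCompIso e _) _)

lemma isIso_of_isIso_app_Q_obj {F F' : DerivedCategory C ⥤ DerivedCategory D} (α : F ⟶ F')
    (h : ∀ K, IsIso (α.app (DerivedCategory.Q.obj K))) : IsIso α := by
  rw [NatTrans.isIso_iff_isIso_app]
  intro X
  let e := DerivedCategory.Q.objObjPreimageIso X
  rw [← NatTrans.isIso_app_iff_of_iso α e]
  exact h _

omit [HasDerivedCategory C] in
lemma isIso_complex_of_isIso_f {K L : CochainComplex C ℤ} (f : K ⟶ L)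
    (h : ∀ n, IsIso (f.f n)) : IsIso f :=
  HomologicalComplex.Hom.isIso_of_components f

lemma isIso_mapDerivedCategory_unit (adj : F ⊣ G) [IsIso adj.unit] :
    IsIso adj.mapDerivedCategory.unit := by
  refine isIso_of_isIso_app_Q_obj _ fun K => ?_
  have : IsIso (adj.mapCochainComplex.unit.app K) :=
    isIso_complex_of_isIso_f _ fun n => inferInstanceAs (IsIso (adj.unit.app (K.X n)))
  rw [Adjunction.mapDerivedCategory, Adjunction.localization_unit_app]
  infer_instance

lemma isIso_mapDerivedCategory_counit (adj : F ⊣ G) [IsIso adj.counit] :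
    IsIso adj.mapDerivedCategory.counit := by
  refine isIso_of_isIso_app_Q_obj _ fun K => ?_
  have : IsIso (adj.mapCochainComplex.counit.app K) :=
    isIso_complex_of_isIso_f _ fun n => inferInstanceAs (IsIso (adj.counit.app (K.X n)))
  rw [Adjunction.mapDerivedCategory, Adjunction.localization_counit_app]
  infer_instance

/-- The counit itself need not be invertible: it is enough that `H` inverts it in each degree of one
complex. -/
lemma isIso_mapDerivedCategory_map_counit_app (adj : F ⊣ G) {K : CochainComplex D ℤ}
    (h : ∀ n, IsIso (H.map (adj.counit.app (K.X n)))) :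
    IsIso (H.mapDerivedCategory.map (adj.mapDerivedCategory.counit.app
      (DerivedCategory.Q.obj K))) := by
  have h₁ : IsIso ((H.mapHomologicalComplex (ComplexShape.up ℤ)).map
      (adj.mapCochainComplex.counit.app K)) := isIso_complex_of_isIso_f _ h
  have h₂ : IsIso (H.mapDerivedCategory.map (DerivedCategory.Q.map
      (adj.mapCochainComplex.counit.app K))) := by
    have := H.mapDerivedCategoryFactors_hom_naturality (adj.mapCochainComplex.counit.app K)
    rw [← IsIso.eq_comp_inv] at this
    rw [this]
    infer_instance
  rw [Adjunction.mapDerivedCategory, Adjunction.localization_counit_app, Functor.map_comp,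
    Functor.map_comp]
  infer_instance

/-- An object is zero exactly when its zero endomorphism is invertible, and `Q` inverts exactly the
quasi-isomorphisms. -/
lemma isZero_Q_obj_iff (K : CochainComplex C ℤ) :
    IsZero (DerivedCategory.Q.obj K) ↔ ∀ n, IsZero (K.homology n) := by
  have h₁ : IsZero (DerivedCategory.Q.obj K) ↔ IsIso (DerivedCategory.Q.map (0 : K ⟶ K)) := by
    rw [Functor.map_zero]
    exact ⟨fun h => ⟨0, h.eq_of_src _ _, h.eq_of_src _ _⟩, 
      fun h => (IsZero.iff_id_eq_zero _).2 (isIsoZeroSelfEquiv _ h)⟩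
  have h₂ (n : ℤ) : IsZero (K.homology n) ↔ QuasiIsoAt (0 : K ⟶ K) n := by
    rw [quasiIsoAt_iff_isIso_homologyMap, HomologicalComplex.homologyMap_zero]
    exact ⟨fun h => ⟨0, h.eq_of_src _ _, h.eq_of_src _ _⟩, 
      fun h => (IsZero.iff_id_eq_zero _).2 (isIsoZeroSelfEquiv _ h)⟩
  rw [h₁, DerivedCategory.isIso_Q_map_iff_quasiIso, quasiIso_iff]
  exact forall_congr' fun n => (h₂ n).symm

lemma isZero_mapDerivedCategory_obj (h : ∀ X, IsZero (F.obj X)) (X : DerivedCategory C) :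
    IsZero (F.mapDerivedCategory.obj X) := by
  let e := DerivedCategory.Q.objObjPreimageIso X
  refine IsZero.of_iso ?_ (F.mapDerivedCategory.mapIso e.symm ≪≫
    F.mapDerivedCategoryFactors.app _)
  refine DerivedCategory.Q.map_isZero ?_
  rw [IsZero.iff_id_eq_zero]
  ext n
  exact (h _).eq_of_src _ _

/-- Exact functors commute with homology, so joint detection of zero objects passes from the abelian
categories to the derived ones. -/
lemma isZero_of_isZero_mapDerivedCategory_obj
    (h : ∀ X, IsZero (F.obj X) → IsZero (K.obj X) → IsZero X)
    (X : DerivedCategory C)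
    (h₁ : IsZero (F.mapDerivedCategory.obj X)) (h₂ : IsZero (K.mapDerivedCategory.obj X)) :
    IsZero X := by
  obtain ⟨L, ⟨e⟩⟩ : ∃ L, Nonempty (DerivedCategory.Q.obj L ≅ X) :=
    ⟨_, ⟨DerivedCategory.Q.objObjPreimageIso X⟩⟩
  refine IsZero.of_iso ?_ e.symm
  replace h₁ := h₁.of_iso (F.mapDerivedCategoryFactors.symm.app _ ≪≫ F.mapDerivedCategory.mapIso e)
  replace h₂ := h₂.of_iso (K.mapDerivedCategoryFactors.symm.app _ ≪≫ K.mapDerivedCategory.mapIso e)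
  dsimp at h₁ h₂
  rw [isZero_Q_obj_iff] at h₁ h₂ ⊢
  intro n
  refine h _ ((h₁ n).of_iso ?_) ((h₂ n).of_iso ?_)
  · exact ((L.sc n).mapHomologyIso F).symm
  · exact ((L.sc n).mapHomologyIso K).symm

end DerivedFunctors

/-! ### Adjunctions with a fully faithful adjoint. -/

namespace CategoryTheory.Adjunction

variable {C D : Type*} [Category* C] [Category* D] {l : C ⥤ D} {r : D ⥤ C} (adj : l ⊣ r)

/-- Under the adjunction bijection, `l.map` becomes composition with the unit. -/
lemma map_bijective_iff (X Y : C) :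
    Function.Bijective (l.map : (X ⟶ Y) → (l.obj X ⟶ l.obj Y)) ↔
      Function.Bijective (fun f : X ⟶ Y => f ≫ adj.unit.app Y) := by
  rw [← (adj.homEquiv X (l.obj Y)).comp_bijective]
  refine iff_of_eq (congrArg _ (funext fun f => ?_))
  simp [homEquiv_unit]

lemma map_bijective_of_isIso_unit_app (X Y : C) [IsIso (adj.unit.app Y)] :
    Function.Bijective (l.map : (X ⟶ Y) → (l.obj X ⟶ l.obj Y)) :=
  (adj.map_bijective_iff X Y).2
    ⟨fun _ _ h => (cancel_mono (adj.unit.app Y)).1 h, fun g => ⟨g ≫ inv (adj.unit.app Y), by simp⟩⟩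

lemma isIso_map_unit_app_of_isIso_counit [IsIso adj.counit] (X : C) :
    IsIso (l.map (adj.unit.app X)) :=
  @IsIso.of_isIso_fac_right _ _ _ _ _ _ _ _
    (NatIso.isIso_app_of_isIso adj.counit (l.obj X)) (IsIso.id _)
    (adj.left_triangle_components X)

lemma isIso_unit_app_obj_of_isIso_counit [IsIso adj.counit] (Y : D) :
    IsIso (adj.unit.app (r.obj Y)) :=
  @IsIso.of_isIso_fac_right _ _ _ _ _ _ _ _ inferInstance (IsIso.id _)
    (adj.right_triangle_components Y)

lemma isIso_map_counit_app_of_isIso_unit [IsIso adj.unit] (Y : D) :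
    IsIso (r.map (adj.counit.app Y)) :=
  @IsIso.of_isIso_fac_left _ _ _ _ _ _ _ _
    (NatIso.isIso_app_of_isIso adj.unit (r.obj Y)) (IsIso.id _)
    (adj.right_triangle_components Y)

include adj in
lemma subsingleton_hom {X : C} {Y : D} (h : IsZero (r.obj Y)) : Subsingleton (l.obj X ⟶ Y) :=
  ⟨fun _ _ => (adj.homEquiv X Y).injective (h.eq_of_tgt _ _)⟩

variable {B : Type*} [Category* B]
  [HasZeroObject C] [Preadditive C] [HasShift C ℤ] [∀ n : ℤ, (shiftFunctor C n).Additive]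
  [Pretriangulated C]
  [HasZeroObject D] [Preadditive D] [HasShift D ℤ] [∀ n : ℤ, (shiftFunctor D n).Additive]
  [Pretriangulated D]
  [HasZeroObject B] [Preadditive B] [HasShift B ℤ] [∀ n : ℤ, (shiftFunctor B n).Additive]
  [Pretriangulated B]

/-- The unit of an adjunction `l ⊣ r` with `r` fully faithful is an isomorphism on the objects
killed by a functor `q` which kills the image of `r`, if `l` and `q` jointly detect zero. -/
lemma isIso_unit_app_of_isZero [l.CommShift ℤ] [l.IsTriangulated] [IsIso adj.counit]
    (q : C ⥤ B) [q.CommShift ℤ] [q.IsTriangulated] (hq : ∀ Y, IsZero (q.obj (r.obj Y)))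
    (hlq : ∀ X, IsZero (l.obj X) → IsZero (q.obj X) → IsZero X) {X : C} (hX : IsZero (q.obj X)) :
    IsIso (adj.unit.app X) := by
  obtain ⟨Z, g, h, mem⟩ := distinguished_cocone_triangle (adj.unit.app X)
  -- The cone of the unit is killed by `l`, which inverts the unit, and by `q`, which kills both
  -- ends of the unit.
  refine (Triangle.isZero₃_iff_isIso₁ _ mem).1 (hlq _ ?_ ?_)
  · refine (Triangle.isZero₃_iff_isIso₁ _ (l.map_distinguished _ mem)).2 ?_
    exact adj.isIso_map_unit_app_of_isIso_counit X
  · exact Triangle.isZero₃_of_isZero₁₂ _ (q.map_distinguished _ mem) hX (hq _)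

/-- The counit of an adjunction `l ⊣ r` with `l` fully faithful is an isomorphism on the objects
killed by a functor `q` which kills the image of `l`, if `r` and `q` jointly detect zero. -/
lemma isIso_counit_app_of_isZero [r.CommShift ℤ] [r.IsTriangulated] [IsIso adj.unit]
    (q : D ⥤ B) [q.CommShift ℤ] [q.IsTriangulated] (hq : ∀ Y, IsZero (q.obj (l.obj Y)))
    (hrq : ∀ X, IsZero (q.obj X) → IsZero (r.obj X) → IsZero X) {X : D} (hX : IsZero (q.obj X)) :
    IsIso (adj.counit.app X) := by
  obtain ⟨Z, g, h, mem⟩ := distinguished_cocone_triangle (adj.counit.app X)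
  refine (Triangle.isZero₃_iff_isIso₁ _ mem).1 (hrq _ ?_ ?_)
  · exact Triangle.isZero₃_of_isZero₁₂ _ (q.map_distinguished _ mem) (hq _) hX
  · refine (Triangle.isZero₃_iff_isIso₁ _ (r.map_distinguished _ mem)).2 ?_
    exact adj.isIso_map_counit_app_of_isIso_unit X

end CategoryTheory.Adjunction

/-! ### Full faithfulness by dévissage on the target. -/

section FullyFaithful

variable {C D : Type*} [Category* C] [Category* D]
  [HasZeroObject C] [Preadditive C] [HasShift C ℤ] [∀ n : ℤ, (shiftFunctor C n).Additive]
  [Pretriangulated C]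
  [HasZeroObject D] [Preadditive D] [HasShift D ℤ] [∀ n : ℤ, (shiftFunctor D n).Additive]
  [Pretriangulated D] (F : C ⥤ D) [F.CommShift ℤ]

/-- The functor `F` is bijective on all morphisms with target `Y`. -/
def BijectiveOnHomsTo : ObjectProperty C := fun Y =>
  ∀ X, Function.Bijective (F.map : (X ⟶ Y) → (F.obj X ⟶ F.obj Y))

variable {F}

omit [HasZeroObject C] [Preadditive C] [HasZeroObject D] [Preadditive D]
  [∀ n : ℤ, (shiftFunctor C n).Additive] [Pretriangulated C]
  [∀ n : ℤ, (shiftFunctor D n).Additive] [Pretriangulated D] [HasShift C ℤ] [HasShift D ℤ] [F.CommShift ℤ] in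
lemma BijectiveOnHomsTo.of_iso {Y Y' : C} (h : BijectiveOnHomsTo F Y) (e : Y ≅ Y') :
    BijectiveOnHomsTo F Y' := fun X => by
  constructor
  · intro f f' hf
    rw [← cancel_mono e.inv]
    exact (h X).1 (by simp only [F.map_comp, hf])
  · intro φ
    obtain ⟨g, hg⟩ := (h X).2 (φ ≫ F.map e.inv)
    exact ⟨g ≫ e.hom, by simp [hg, ← F.map_comp]⟩

omit [HasZeroObject C] [Preadditive C] [HasZeroObject D] [Preadditive D]
  [∀ n : ℤ, (shiftFunctor C n).Additive] [Pretriangulated C]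
  [∀ n : ℤ, (shiftFunctor D n).Additive] [Pretriangulated D]
  [HasShift C ℤ] [HasShift D ℤ] [F.CommShift ℤ] in
lemma BijectiveOnHomsTo.of_natIso {F' : C ⥤ D} {Y : C} (h : BijectiveOnHomsTo F Y)
    (e : F ≅ F') : BijectiveOnHomsTo F' Y := fun X => by
  have : (F'.map : (X ⟶ Y) → _) =
      (fun f => e.inv.app X ≫ f ≫ e.hom.app Y) ∘ (F.map : (X ⟶ Y) → _) := by
    ext f
    simp
  rw [this]
  refine Function.Bijective.comp ⟨fun f g hfg => by simpa using hfg, fun f => ?_⟩ (h X)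
  exact ⟨e.hom.app X ≫ f ≫ e.inv.app Y, by simp⟩

omit [HasZeroObject C] [Preadditive C] [HasZeroObject D] [Preadditive D]
  [∀ n : ℤ, (shiftFunctor C n).Additive] [Pretriangulated C]
  [∀ n : ℤ, (shiftFunctor D n).Additive] [Pretriangulated D] in
lemma BijectiveOnHomsTo.shift {Y : C} (h : BijectiveOnHomsTo F Y) (n : ℤ) :
    BijectiveOnHomsTo F (Y⟦n⟧) := fun X => by
  -- Every source is an `n`-fold shift, so morphisms to `Y⟦n⟧` come from morphisms to `Y`.
  let e : X⟦-n⟧⟦n⟧ ≅ X := shiftNegShift X n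
  have key (g : X⟦-n⟧ ⟶ Y) : F.map (g⟦n⟧') = (F.commShiftIso n).hom.app _ ≫
      (F.map g)⟦n⟧' ≫ (F.commShiftIso n).inv.app _ := by
    simp
  constructor
  · intro f f' hf
    obtain ⟨g, hg⟩ := (shiftFunctor C n).map_surjective (e.hom ≫ f)
    obtain ⟨g', hg'⟩ := (shiftFunctor C n).map_surjective (e.hom ≫ f')
    have : g = g' := by
      refine (h _).1 ((shiftFunctor D n).map_injective ?_)
      rw [← cancel_mono ((F.commShiftIso n).inv.app _),
        ← cancel_epi ((F.commShiftIso n).hom.app _), ← key, ← key, hg, hg', F.map_comp,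
        F.map_comp, hf]
    rw [← cancel_epi e.hom, ← hg, ← hg', this]
  · intro φ
    obtain ⟨ψ, hψ⟩ := (shiftFunctor D n).map_surjective
      ((F.commShiftIso n).inv.app _ ≫ F.map e.hom ≫ φ ≫ (F.commShiftIso n).hom.app _)
    obtain ⟨g, rfl⟩ := (h _).2 ψ
    exact ⟨e.inv ≫ g⟦n⟧', by rw [F.map_comp, key, hψ]; simp [← F.map_comp_assoc]⟩

/-- This is the five lemma for the long exact sequences of morphisms from `X` into the triangle and
from `F.obj X` into its image. -/
lemma BijectiveOnHomsTo.obj₂ [F.IsTriangulated] {T : Triangle C} (hT : T ∈ distTriang C)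
    (h₁ : BijectiveOnHomsTo F T.obj₁) (h₃ : BijectiveOnHomsTo F T.obj₃) :
    BijectiveOnHomsTo F T.obj₂ := fun X => by
  have hF := F.map_distinguished _ hT
  constructor
  · refine (injective_iff_map_eq_zero F.mapAddHom).2 fun f hf => ?_
    replace hf : F.map f = 0 := hf
    obtain ⟨a, rfl⟩ := T.coyoneda_exact₂ hT f ((h₃ X).1 (by simp [hf]))
    -- Once shifted, `a` should factor through `T.mor₃`, which forces `a ≫ T.mor₁` to vanish. The
    -- factorization is found in the target category and lifted using the bijection for `T.obj₃`.
    have h : (F.map (a⟦1⟧') ≫ (F.commShiftIso (1 : ℤ)).hom.app _) ≫ (F.map T.mor₁)⟦1⟧' = 0 := by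
      rw [Category.assoc, ← F.commShiftIso_hom_naturality, ← F.map_comp_assoc, ← Functor.map_comp,
        F.commShiftIso_hom_naturality, hf, Functor.map_zero, comp_zero]
    obtain ⟨ψ, hψ⟩ : ∃ ψ, F.map (a⟦1⟧') ≫ (F.commShiftIso (1 : ℤ)).hom.app T.obj₁ =
      ψ ≫ F.map T.mor₃ ≫ (F.commShiftIso (1 : ℤ)).hom.app T.obj₁ :=
        Triangle.coyoneda_exact₁ _ hF _ h
    obtain ⟨c, rfl⟩ := (h₃ _).2 ψ
    have hc : a⟦1⟧' = c ≫ T.mor₃ := (h₁.shift 1 _).1 (by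
      rw [← cancel_mono ((F.commShiftIso (1 : ℤ)).hom.app T.obj₁), hψ, F.map_comp, Category.assoc])
    refine (shiftFunctor C (1 : ℤ)).map_injective ?_
    rw [Functor.map_comp, hc, Category.assoc, comp_distTriang_mor_zero₃₁ _ hT, comp_zero,
      Functor.map_zero]
  · intro f
    obtain ⟨b, hb⟩ := (h₃ X).2 (f ≫ F.map T.mor₂)
    obtain ⟨b', rfl⟩ := T.coyoneda_exact₃ hT b ((h₁.shift 1 X).1 (by
      rw [F.map_comp, hb, Category.assoc, ← F.map_comp, comp_distTriang_mor_zero₂₃ _ hT]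
      simp))
    obtain ⟨g, hg⟩ : ∃ g, f - F.map b' = g ≫ F.map T.mor₁ := Triangle.coyoneda_exact₂ _ hF (f - F.map b')
      (show (f - F.map b') ≫ F.map T.mor₂ = 0 by rw [Preadditive.sub_comp, ← hb, F.map_comp, sub_self])
    obtain ⟨c, rfl⟩ := (h₁ X).2 g
    refine ⟨b' + c ≫ T.mor₁, ?_⟩
    rw [F.map_add, F.map_comp, ← hg, add_sub_cancel]

end FullyFaithful

/-! ### The cone of a counit as a left adjoint. -/

section LeftAdjoint

variable {C D S : Type*} [Category* C] [Category* D] [Category* S]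
  [HasZeroObject C] [Preadditive C] [HasShift C ℤ] [∀ n : ℤ, (shiftFunctor C n).Additive]
  [Pretriangulated C]
  [Preadditive D] [HasZeroObject S] [Preadditive S] [HasShift S ℤ]
  [∀ n : ℤ, (shiftFunctor S n).Additive] [Pretriangulated S]

/-- A fully faithful functor `i` whose essential image is the kernel of the right adjoint `p` of a
fully faithful functor `d` has a left adjoint, and the cone of the counit of `d ⊣ p` is given
by the unit of the adjunction. -/
lemma exists_leftAdjoint_of_kernel {i : D ⥤ C} [i.Full] [i.Faithful] [i.Additive]
    {d : S ⥤ C} {p : C ⥤ S} (adj : d ⊣ p) [IsIso adj.unit] [d.CommShift ℤ] [p.CommShift ℤ]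
    [p.IsTriangulated] (hpi : ∀ Y, IsZero (p.obj (i.obj Y)))
    (hi : ∀ X, IsZero (p.obj X) → i.essImage X) :
    ∃ (L : C ⥤ D) (adj' : L ⊣ i), ∀ Z, ∃ δ,
      Triangle.mk (adj.counit.app Z) (adj'.unit.app Z) δ ∈ distTriang C := by
  have h (Z : C) : ∃ (c : D) (g : Z ⟶ i.obj c) (δ : _),
      Triangle.mk (adj.counit.app Z) g δ ∈ distTriang C := by
    obtain ⟨W, g, δ, mem⟩ := distinguished_cocone_triangle (adj.counit.app Z)
    -- Full faithfulness of `d` makes `p` invert the counit, so the cone lies in the kernel of `p`,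
    -- which is the image of `i`.
    have hW : IsZero (p.obj W) := by
      exact (Triangle.isZero₃_iff_isIso₁ _ (p.map_distinguished _ mem)).2
        (adj.isIso_map_counit_app_of_isIso_unit Z)
    obtain ⟨c, ⟨e⟩⟩ := hi _ hW
    refine ⟨c, g ≫ e.inv, e.hom ≫ δ, isomorphic_distinguished _ mem _ ?_⟩
    exact Triangle.isoMk _ _ (Iso.refl _) (Iso.refl _) e
      ((Category.comp_id _).trans (Category.id_comp _).symm)
      ((Category.assoc _ _ _).trans ((congrArg (g ≫ ·) e.inv_hom_id).trans
        ((Category.comp_id _).trans (Category.id_comp _).symm)))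
      ((congrArg (_ ≫ ·) (CategoryTheory.Functor.map_id _ _)).trans (Category.comp_id _))
  choose c g δ mem using h
  have hg (Z : C) (Y : D) : Function.Bijective (fun f : c Z ⟶ Y => g Z ≫ i.map f) := by
    constructor
    -- The difference of two such maps factors through a shift of `d.obj (p.obj Z)`, which has no
    -- nonzero map to the image of `i`.
    · intro f f' (hf : g Z ≫ i.map f = g Z ≫ i.map f')
      refine i.map_injective ?_
      rw [← sub_eq_zero]
      have : Subsingleton ((d.obj (p.obj Z))⟦(1 : ℤ)⟧ ⟶ i.obj Y) := by
        refine ⟨fun φ φ' => ?_⟩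
        rw [← cancel_epi ((d.commShiftIso (1 : ℤ)).hom.app (p.obj Z))]
        exact (adj.subsingleton_hom (hpi Y)).elim _ _
      obtain ⟨φ, hφ⟩ := Triangle.yoneda_exact₃ _ (mem Z) (i.map f - i.map f')
        (show g Z ≫ _ = 0 by rw [Preadditive.comp_sub, hf, sub_self])
      rw [hφ, show φ = 0 from this.elim _ _]
      exact comp_zero
    · intro f
      obtain ⟨φ, hφ⟩ := Triangle.yoneda_exact₂ _ (mem Z) f
        ((adj.subsingleton_hom (hpi Y)).elim _ _)
      obtain ⟨f', rfl⟩ := i.map_surjective φ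
      exact ⟨f', hφ.symm⟩
  exact ⟨_, Adjunction.adjunctionOfEquivLeft (fun Z Y => Equiv.ofBijective _ (hg Z Y))
    (fun _ _ _ _ _ => by simp), fun Z => ⟨δ Z, by simpa using mem Z⟩⟩

end LeftAdjoint

/-! ### The equivalence between two glued triangulated categories. -/

section Reflection

variable {P M R A B : Type*} [Category* P] [Category* M] [Category* R] [Category* A] [Category* B]
  [HasZeroObject P] [Preadditive P] [HasShift P ℤ] [∀ n : ℤ, (shiftFunctor P n).Additive]
  [Pretriangulated P]
  [HasZeroObject M] [Preadditive M] [HasShift M ℤ] [∀ n : ℤ, (shiftFunctor M n).Additive]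
  [Pretriangulated M]
  [HasZeroObject R] [Preadditive R] [HasShift R ℤ] [∀ n : ℤ, (shiftFunctor R n).Additive]
  [Pretriangulated R]
  [HasZeroObject A] [Preadditive A] [HasShift A ℤ] [∀ n : ℤ, (shiftFunctor A n).Additive]
  [Pretriangulated A]
  [HasZeroObject B] [Preadditive B] [HasShift B ℤ] [∀ n : ℤ, (shiftFunctor B n).Additive]
  [Pretriangulated B]

/-- Let `P` and `M` be glued from `A` and `B` (via restriction functors `σ, ρ` and `σ', ρ'`), let
`R` be a category of arrows in `M`, and let `E : P ⥤ R` be a functor sending `X` to an arrow from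
`i' (σ X)` to `j' (ρ X)`. Then sending `X` to the cone of this arrow is an equivalence. -/
theorem exists_triangulated_equivalence_of_gluing
    {ρ : P ⥤ B} {e : B ⥤ P} {σ : P ⥤ A} {i : A ⥤ P}
    {ρ' : M ⥤ B} {k j' : B ⥤ M} {σ' : M ⥤ A} {i' : A ⥤ M}
    {E : P ⥤ R} {ev₀ ev₁ : R ⥤ M} {d z iR : M ⥤ R}
    [ρ.CommShift ℤ] [ρ.IsTriangulated] [σ.CommShift ℤ] [σ.IsTriangulated]
    [ρ'.CommShift ℤ] [ρ'.IsTriangulated] [σ'.CommShift ℤ] [σ'.IsTriangulated]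
    [ev₀.CommShift ℤ] [ev₀.IsTriangulated] [ev₁.CommShift ℤ] [ev₁.IsTriangulated]
    [E.CommShift ℤ] [E.IsTriangulated] [iR.CommShift ℤ] [iR.IsTriangulated] [d.CommShift ℤ]
    (adjρ : ρ ⊣ e) [IsIso adjρ.counit] (adjσ : σ ⊣ i) [IsIso adjσ.counit]
    (hρi : ∀ X, IsZero (ρ.obj (i.obj X)))
    (hP : ∀ X, IsZero (σ.obj X) → IsZero (ρ.obj X) → IsZero X)
    (adjρ' : ρ' ⊣ k) [IsIso adjρ'.counit] (adjσ' : i' ⊣ σ') [IsIso adjσ'.unit]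
    (adjj' : j' ⊣ ρ') [IsIso adjj'.unit] [j'.PreservesZeroMorphisms]
    (hρi' : ∀ X, IsZero (ρ'.obj (i'.obj X))) (hσk : ∀ X, IsZero (σ'.obj (k.obj X)))
    (hM : ∀ X, IsZero (σ'.obj X) → IsZero (ρ'.obj X) → IsZero X)
    (adjd : d ⊣ ev₀) [IsIso adjd.unit] (adjd' : ev₁ ⊣ d) [IsIso adjd'.counit]
    (adjR : iR ⊣ ev₁) [IsIso adjR.unit] (adjz : ev₀ ⊣ z) [IsIso adjz.counit]
    (hRi : ∀ X, IsZero (ev₀.obj (iR.obj X))) (hRz : ∀ X, IsZero (ev₁.obj (z.obj X)))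
    (hR : ∀ X, IsZero (ev₀.obj X) → IsZero (ev₁.obj X) → IsZero X)
    (α₀ : E ⋙ ev₀ ≅ σ ⋙ i') (α₁ : E ⋙ ev₁ ≅ ρ ⋙ j')
    (hE : ∀ X, IsIso (σ'.map (ev₁.map (adjd.counit.app (E.obj (e.obj X)))))) :
    ∃ (F : P ⥤ M) (_ : F.CommShift ℤ), F.IsTriangulated ∧ F.IsEquivalence := by
  have : iR.Full := adjR.fullyFaithfulLOfIsIsoUnit.full
  have : iR.Faithful := adjR.fullyFaithfulLOfIsIsoUnit.faithful
  obtain ⟨L, adjL, mem⟩ := exists_leftAdjoint_of_kernel adjd hRi (i := iR) (fun X hX => by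
    have := adjR.isIso_counit_app_of_isZero ev₀ hRi hR hX
    exact ⟨_, ⟨asIso (adjR.counit.app X)⟩⟩)
  let _ := adjL.leftAdjointCommShift ℤ
  have := adjL.commShift_of_rightAdjoint ℤ
  have : L.IsTriangulated := adjL.isTriangulated_leftAdjoint
  -- By adjunction these are morphisms from `j' (ρ X)` to `i' (σ Y)`, hence from `ρ X` to `ρ' (i' (σ
  -- Y))`, which is zero.
  have hzero (X Y : P) : Subsingleton (E.obj X ⟶ d.obj (ev₀.obj (E.obj Y))) := by
    refine ⟨fun f g => (adjd'.homEquiv _ _).symm.injective ?_⟩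
    rw [← cancel_epi (α₁.inv.app X), ← cancel_mono (α₀.hom.app Y)]
    exact (adjj'.subsingleton_hom (hρi' _)).elim _ _
  have hzero' (X Y : P) : Subsingleton (E.obj X ⟶ (d.obj (ev₀.obj (E.obj Y)))⟦(1 : ℤ)⟧) := by
    let e := d.mapIso (((E ⋙ ev₀).commShiftIso (1 : ℤ)).app Y) ≪≫
      (d.commShiftIso (1 : ℤ)).app _
    refine ⟨fun f g => ?_⟩
    rw [← cancel_mono e.inv]
    exact (hzero X (Y⟦(1 : ℤ)⟧)).elim _ _
  -- The unit at `E Y` has `d (ev₀ (E Y))` as its fibre, and `E X` has no nonzero map to this object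
  -- or to its shift.
  have hL (X Y : P) : Function.Bijective (L.map : (E.obj X ⟶ E.obj Y) → _) := by
    rw [adjL.map_bijective_iff]
    obtain ⟨δ, hδ⟩ := mem (E.obj Y)
    constructor
    · intro f f' (hf : f ≫ adjL.unit.app (E.obj Y) = f' ≫ adjL.unit.app (E.obj Y))
      rw [← sub_eq_zero]
      obtain ⟨ψ, hψ⟩ := Triangle.coyoneda_exact₂ _ hδ (f - f')
        ((Preadditive.sub_comp _ _ _).trans (sub_eq_zero.2 hf))
      rw [hψ, show ψ = 0 from (hzero X Y).elim _ _]
      exact zero_comp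
    · intro f
      obtain ⟨ψ, hψ⟩ := Triangle.coyoneda_exact₃ _ hδ f ((hzero' X Y).elim _ _)
      exact ⟨ψ, hψ.symm⟩
  have hT (X : P) : ∃ δ, Triangle.mk (ev₁.map (adjd.counit.app (E.obj X)))
      (ev₁.map (adjL.unit.app (E.obj X))) δ ∈ distTriang M := by
    obtain ⟨δ, hδ⟩ := mem (E.obj X)
    exact ⟨_, ev₁.map_distinguished _ hδ⟩
  -- The source of the arrow is killed by `ρ'`, so after `ρ'` the cone agrees with the target of the
  -- arrow.
  have hFρ : Nonempty ((E ⋙ L) ⋙ ρ' ≅ ρ) := by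
    let τ : E ⋙ ev₁ ⋙ ρ' ⟶ E ⋙ L ⋙ iR ⋙ ev₁ ⋙ ρ' :=
      Functor.whiskerLeft E (Functor.whiskerRight adjL.unit (ev₁ ⋙ ρ'))
    have : IsIso τ := by
      rw [NatTrans.isIso_iff_isIso_app]
      intro X
      obtain ⟨δ, hδ⟩ := hT X
      refine (Triangle.isZero₁_iff_isIso₂ _ (ρ'.map_distinguished _ hδ)).1 ?_
      exact (hρi' (σ.obj X)).of_iso
        (ρ'.mapIso ((asIso adjd'.counit).app _ ≪≫ α₀.app X))
    let e₁ : (E ⋙ L) ⋙ ρ' ≅ E ⋙ L ⋙ iR ⋙ ev₁ ⋙ ρ' :=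
      Functor.isoWhiskerLeft (E ⋙ L) (Functor.isoWhiskerRight (asIso adjR.unit) ρ')
    let e₂ : E ⋙ ev₁ ⋙ ρ' ≅ ρ ⋙ j' ⋙ ρ' := Functor.isoWhiskerRight α₁ ρ'
    let e₃ : ρ ⋙ j' ⋙ ρ' ≅ ρ := (Functor.isoWhiskerLeft ρ (asIso adjj'.unit)).symm
    exact ⟨e₁ ≪≫ (asIso τ).symm ≪≫ e₂ ≪≫ e₃⟩
  obtain ⟨φ⟩ := hFρ
  -- On the image of `e` the arrow becomes invertible after `σ'`, so its cone is killed by `σ'` and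
  -- therefore lies in the image of `k`.
  have hσFe (X : B) : IsZero (σ'.obj (L.obj (E.obj (e.obj X)))) := by
    obtain ⟨δ, hδ⟩ := hT (e.obj X)
    refine IsZero.of_iso ?_ (σ'.mapIso ((asIso adjR.unit).app _))
    exact (Triangle.isZero₃_iff_isIso₁ _ (σ'.map_distinguished _ hδ)).2 (hE X)
  have hFe (X : B) : IsIso (adjρ'.unit.app (L.obj (E.obj (e.obj X)))) :=
    adjρ'.isIso_unit_app_of_isZero σ' hσk (fun X h₁ h₂ => hM X h₂ h₁) (hσFe X)
  have hEi (X : A) : IsZero (ev₁.obj (E.obj (i.obj X))) :=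
    (j'.map_isZero (hρi X)).of_iso (α₁.app _)
  -- The arrow `E (i X)` has zero target, so morphisms into it are determined by their sources.
  have hz (X : A) : IsIso (adjz.unit.app (E.obj (i.obj X))) :=
    adjz.isIso_unit_app_of_isZero ev₁ hRz hR (hEi X)
  -- Morphisms to `e Y` are computed by `ρ`, those to its image by `ρ'`, and `φ` identifies the two.
  have he (Y : B) : BijectiveOnHomsTo (E ⋙ L) (e.obj Y) := by
    have : IsIso (adjρ.unit.app (e.obj Y)) := adjρ.isIso_unit_app_obj_of_isIso_counit Y
    have h : BijectiveOnHomsTo ρ (e.obj Y) := fun X =>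
      adjρ.map_bijective_of_isIso_unit_app X (e.obj Y)
    exact fun X => ((@Adjunction.map_bijective_of_isIso_unit_app _ _ _ _ _ _ adjρ' _ _
      (hFe Y)).of_comp_iff' _).1
      (h.of_natIso φ.symm X)
  -- The chain of bijections is `σ`, then `i'`, compared through `α₀` with `E` followed by `ev₀`.
  -- Cancelling `ev₀` leaves `E`, and `hL` adds `L`.
  have hi (Y : A) : BijectiveOnHomsTo (E ⋙ L) (i.obj Y) := by
    have : IsIso (adjσ.unit.app (i.obj Y)) := adjσ.isIso_unit_app_obj_of_isIso_counit Y
    have h : BijectiveOnHomsTo (σ ⋙ i') (i.obj Y) := fun X =>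
      (adjσ'.map_bijective_of_isIso_unit_app _ _).comp
        (adjσ.map_bijective_of_isIso_unit_app X (i.obj Y))
    exact fun X => (hL _ _).comp (((adjz.map_bijective_of_isIso_unit_app _ _).of_comp_iff' _).1
      (h.of_natIso α₀.symm X))
  have hF (Y : P) : BijectiveOnHomsTo (E ⋙ L) Y := by
    obtain ⟨W, g, δ, hδ⟩ := distinguished_cocone_triangle (adjρ.unit.app Y)
    have hW : IsZero (ρ.obj W) :=
      (Triangle.isZero₃_iff_isIso₁ _ (ρ.map_distinguished _ hδ)).2
        (adjρ.isIso_map_unit_app_of_isIso_counit Y)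
    have := adjσ.isIso_unit_app_of_isZero ρ hρi hP hW
    -- The rotated triangle exhibits `Y` as an extension of `e (ρ Y)` by a shift of an object in the
    -- image of `i`.
    exact BijectiveOnHomsTo.obj₂ (inv_rot_of_distTriang _ hδ)
      (((hi _).of_iso (asIso (adjσ.unit.app W)).symm).shift (-1)) (he _)
  have hfull : (E ⋙ L).Full := ⟨fun {X Y} => (hF Y X).2⟩
  have hfaithful : (E ⋙ L).Faithful := ⟨fun {X Y} => @(hF Y X).1⟩
  have hk (X : B) : (E ⋙ L).essImage (k.obj X) :=
    ⟨e.obj X, ⟨asIso (adjρ'.unit.app (L.obj (E.obj (e.obj X)))) ≪≫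
      k.mapIso (φ.app _ ≪≫ (asIso adjρ.counit).app X)⟩⟩
  have hi' (X : A) : (E ⋙ L).essImage (i'.obj X) := by
    obtain ⟨δ, hδ⟩ := hT (i.obj X)
    -- The cone of an arrow with zero target is the shift of its source, so `i' X` is reached from
    -- `i X` shifted by -1.
    have : IsIso δ := (Triangle.isZero₂_iff_isIso₃ _ hδ).1 (hEi X)
    let e₁ : (E ⋙ L).obj (i.obj X) ≅ (i'.obj X)⟦(1 : ℤ)⟧ :=
      (asIso adjR.unit).app _ ≪≫ asIso δ ≪≫ (shiftFunctor M (1 : ℤ)).mapIso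
        ((asIso adjd'.counit).app _ ≪≫ α₀.app _ ≪≫ i'.mapIso ((asIso adjσ.counit).app X))
    exact ⟨(i.obj X)⟦(-1 : ℤ)⟧, ⟨((E ⋙ L).commShiftIso (-1 : ℤ)).app _ ≪≫
      (shiftFunctor M (-1 : ℤ)).mapIso e₁ ≪≫ shiftShiftNeg _ _⟩⟩
  have hess : (E ⋙ L).EssSurj := ⟨fun N => by
    obtain ⟨W, g, δ, hδ⟩ := distinguished_cocone_triangle (adjρ'.unit.app N)
    have hW : IsZero (ρ'.obj W) :=
      (Triangle.isZero₃_iff_isIso₁ _ (ρ'.map_distinguished _ hδ)).2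
        (adjρ'.isIso_map_unit_app_of_isIso_counit N)
    have := adjσ'.isIso_counit_app_of_isZero ρ' hρi' (fun X h₁ h₂ => hM X h₂ h₁) hW
    -- The essential image of a full triangulated functor is closed under extensions, and `N` lies
    -- between an object from `k` and one from `i'`.
    exact (E ⋙ L).essImage.ext_of_isTriangulatedClosed₁ _ hδ (hk _)
      ((E ⋙ L).essImage.prop_of_iso (@asIso _ _ _ _ _ this) (hi' _))⟩
  exact ⟨E ⋙ L, inferInstance, inferInstance, {}⟩

end Reflection

/-! ### Exactness of the zero functor. -/

section ZeroFunctor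

variable (C D : Type*) [Category* C] [Category* D] [HasZeroMorphisms D] [HasZeroObject D]

open ZeroObject

/-- The functor which sends all objects to zero. -/
noncomputable abbrev zeroFunctor : C ⥤ D := (Functor.const C).obj 0

instance : PreservesFiniteLimits (zeroFunctor C D) :=
  ⟨fun _ _ _ => Functor.preservesLimitsOfShape_of_isZero _ (Functor.isZero _ fun _ => isZero_zero D) _⟩

instance : PreservesFiniteColimits (zeroFunctor C D) :=
  ⟨fun _ _ _ => Functor.preservesColimitsOfShape_of_isZero _ (Functor.isZero _ fun _ => isZero_zero D) _⟩

end ZeroFunctor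

/-! ### Building diagrams on the poset with an added source. -/

namespace SourceExtension

variable {Y : Type a} [PartialOrder Y] (Y₀ : Set Y) (A : Type u) [Category.{v} A]

/-- The inclusion of `Y` in `Y ∪ {*}`. -/
def incl : Y ⥤ SourceExtension Y₀ :=
  Monotone.functor (f := SourceExtension.of) (fun _ _ h => h)

/-- The restriction of diagrams to `Y`. -/
abbrev restr : (SourceExtension Y₀ ⥤ A) ⥤ (Y ⥤ A) :=
  (Functor.whiskeringLeft _ _ A).obj (incl Y₀)

/-- The evaluation at `*`. -/
abbrev evStar : (SourceExtension Y₀ ⥤ A) ⥤ A := (evaluation _ A).obj star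

variable {Y₀ A}

/-- The morphism from `*` to an element above an element of `Y₀`. -/
def starHom {y : Y} (h : ∃ y₀ ∈ Y₀, y₀ ≤ y) : (star : SourceExtension Y₀) ⟶ (incl Y₀).obj y :=
  homOfLE h

/-- Constructor for diagrams on `Y ∪ {*}`. -/
def mkObj (K : A) (M : Y ⥤ A) (g : ∀ y, (∃ y₀ ∈ Y₀, y₀ ≤ y) → (K ⟶ M.obj y))
    (hg : ∀ ⦃y y'⦄ (f : y ⟶ y') h h', g y h ≫ M.map f = g y' h') : SourceExtension Y₀ ⥤ A where
  obj
    | star => K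
    | of y => M.obj y
  map {p q} f :=
    match p, q, f with
    | star, star, _ => 𝟙 _
    | star, of y, f => g y (leOfHom f)
    | of _, star, f => (leOfHom f : False).elim
    | of y, of y', f => M.map (homOfLE (leOfHom f : y ≤ y'))
  map_id p := by
    cases p
    · rfl
    · exact M.map_id _
  map_comp {p q r} f f' := by
    rcases p with _ | p <;> rcases q with _ | q <;> rcases r with _ | r
    · exact (Category.id_comp _).symm
    · exact (Category.id_comp _).symm
    · exact (leOfHom f' : False).elim
    · exact (hg _ _ _).symm
    · exact (leOfHom f : False).elim
    · exact (leOfHom f : False).elim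
    · exact (leOfHom f' : False).elim
    · exact M.map_comp (homOfLE (leOfHom f : p ≤ q)) (homOfLE (leOfHom f' : q ≤ r))

/-- Constructor for morphisms of diagrams on `Y ∪ {*}`. -/
def mkHom {F G : SourceExtension Y₀ ⥤ A} (φ : F.obj star ⟶ G.obj star)
    (ψ : incl Y₀ ⋙ F ⟶ incl Y₀ ⋙ G)
    (h : ∀ y (h : ∃ y₀ ∈ Y₀, y₀ ≤ y), F.map (starHom h) ≫ ψ.app y = φ ≫ G.map (starHom h)) :
    F ⟶ G where
  app
    | star => φ
    | of y => ψ.app y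
  naturality p q f := by
    rcases p with _ | p <;> rcases q with _ | q
    · rw [Subsingleton.elim f (𝟙 _), F.map_id, G.map_id]
      exact (Category.id_comp _).trans (Category.comp_id _).symm
    · exact h q (leOfHom f)
    · exact (leOfHom f : False).elim
    · exact ψ.naturality (homOfLE (leOfHom f : p ≤ q))

lemma hom_ext {F G : SourceExtension Y₀ ⥤ A} {f g : F ⟶ G} (h : f.app star = g.app star)
    (h' : ∀ y, f.app (of y) = g.app (of y)) : f = g := by
  ext p
  cases p
  · exact h
  · exact h' _

variable {C : Type*} [Category* C]

/-- Constructor for functors to the category of diagrams on `Y ∪ {*}`. -/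
def lift (K : C ⥤ A) (M : C ⥤ Y ⥤ A)
    (g : ∀ X y, (∃ y₀ ∈ Y₀, y₀ ≤ y) → (K.obj X ⟶ (M.obj X).obj y))
    (hg : ∀ X ⦃y y'⦄ (f : y ⟶ y') h h', g X y h ≫ (M.obj X).map f = g X y' h')
    (hg' : ∀ ⦃X X'⦄ (f : X ⟶ X') y h, g X y h ≫ (M.map f).app y = K.map f ≫ g X' y h) :
    C ⥤ SourceExtension Y₀ ⥤ A where
  obj X := mkObj (K.obj X) (M.obj X) (g X) (hg X)
  map {X X'} f := mkHom (F := mkObj (K.obj X) (M.obj X) (g X) (hg X))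
    (G := mkObj (K.obj X') (M.obj X') (g X') (hg X')) (K.map f)
    { app := (M.map f).app, naturality := fun _ _ φ => (M.map f).naturality φ } (hg' f)
  map_id X := hom_ext (K.map_id X) (fun y => congr_app (M.map_id X) y)
  map_comp f g := hom_ext (K.map_comp f g) (fun y => congr_app (M.map_comp f g) y)

section

variable [Abelian A] (K : C ⥤ A) (M : C ⥤ Y ⥤ A)
    (g : ∀ X y, (∃ y₀ ∈ Y₀, y₀ ≤ y) → (K.obj X ⟶ (M.obj X).obj y)) (hg hg')

instance [PreservesFiniteLimits K] [PreservesFiniteLimits M] :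
    PreservesFiniteLimits (lift K M g hg hg') := by
  refine preservesFiniteLimits_of_evaluation _ fun p => ?_
  rcases p with _ | y
  · exact inferInstanceAs (PreservesFiniteLimits K)
  · exact inferInstanceAs (PreservesFiniteLimits (M ⋙ (evaluation _ _).obj y))

instance [PreservesFiniteColimits K] [PreservesFiniteColimits M] :
    PreservesFiniteColimits (lift K M g hg hg') := by
  refine preservesFiniteColimits_of_evaluation _ fun p => ?_
  rcases p with _ | y
  · exact inferInstanceAs (PreservesFiniteColimits K)
  · exact inferInstanceAs (PreservesFiniteColimits (M ⋙ (evaluation _ _).obj y))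

end

end SourceExtension

lemma additive_of_preservesFiniteLimits {C D : Type*} [Category* C] [Abelian C] [Category* D]
    [Abelian D] (F : C ⥤ D) [PreservesFiniteLimits F] : F.Additive :=
  F.additive_of_preserves_binary_products

/-! ### Exactness of finite products and coproducts over Y₀. -/

section Sections

variable {Y : Type a} (Y₀ : Set Y) [Category.{b} Y] (A : Type u) [Category.{v} A] [Abelian A] [Finite Y]

/-- The restriction of diagrams on `Y` to the discrete category `Y₀`. -/
abbrev restrDiscrete : (Y ⥤ A) ⥤ (Discrete Y₀ ⥤ A) :=
  (Functor.whiskeringLeft _ _ A).obj (Discrete.functor Subtype.val)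

/-- The product over `y₀ ∈ Y₀` of the values at `y₀` of a diagram. -/
noncomputable abbrev prodOver : (Y ⥤ A) ⥤ A := restrDiscrete Y₀ A ⋙ lim

/-- The coproduct over `y₀ ∈ Y₀` of the values at `y₀` of a diagram. -/
noncomputable abbrev coprodOver : (Y ⥤ A) ⥤ A := restrDiscrete Y₀ A ⋙ colim

instance : HasBiproductsOfShape Y₀ A :=
  have := Abelian.hasFiniteBiproducts (C := A)
  inferInstance

/-- The product over `Y₀` identifies with the coproduct over `Y₀`. -/
noncomputable def prodOverIsoCoprodOver : prodOver Y₀ A ≅ coprodOver Y₀ A :=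
  Functor.isoWhiskerLeft _ HasBiproductsOfShape.colimIsoLim.symm

instance : PreservesFiniteLimits (prodOver Y₀ A) := inferInstance

instance : PreservesFiniteColimits (coprodOver Y₀ A) := inferInstance

/-- Products preserve limits and coproducts preserve colimits; the biproduct isomorphism gives each
of them both properties. This is what makes the Kan extensions exact. -/
instance : PreservesFiniteColimits (prodOver Y₀ A) :=
  preservesFiniteColimits_of_natIso (prodOverIsoCoprodOver Y₀ A).symm

instance : PreservesFiniteLimits (coprodOver Y₀ A) :=
  preservesFiniteLimits_of_natIso (prodOverIsoCoprodOver Y₀ A)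

end Sections

/-! ### Extension by zero from the source, and right Kan extension. -/

namespace SourceExtension

variable {Y : Type a} [PartialOrder Y] (Y₀ : Set Y) (A : Type u) [Category.{v} A] [Abelian A]

open ZeroObject

/-- The extension by zero of an object placed at `*`. -/
noncomputable def extStar : A ⥤ (SourceExtension Y₀ ⥤ A) :=
  lift (𝟭 A) (zeroFunctor A (Y ⥤ A)) (fun _ _ _ => 0) (by simp) (by simp)

lemma isZero_extStar_obj_obj_of (X : A) (y : Y) : IsZero (((extStar Y₀ A).obj X).obj (of y)) :=
  ((isZero_zero (Y ⥤ A)).obj y : IsZero ((0 : Y ⥤ A).obj y))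

lemma isZero_restr_obj_extStar_obj (X : A) : IsZero ((restr Y₀ A).obj ((extStar Y₀ A).obj X)) :=
  isZero_zero (Y ⥤ A)

/-- The extension by zero from `*` is right adjoint to the evaluation at `*`. -/
noncomputable def evStarAdj : evStar Y₀ A ⊣ extStar Y₀ A :=
  Adjunction.mkOfUnitCounit
    { unit :=
        { app := fun X => mkHom (𝟙 (X.obj star)) 0 (fun y _ => (isZero_extStar_obj_obj_of Y₀ A _ y).eq_of_tgt _ _)
          naturality := fun X X' f => hom_ext
            ((Category.comp_id (f.app star)).trans (Category.id_comp _).symm)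
            (fun y => (isZero_extStar_obj_obj_of Y₀ A _ y).eq_of_tgt _ _) }
      counit :=
        { app := fun X => 𝟙 X
          naturality := fun X X' f => (Category.comp_id f).trans (Category.id_comp f).symm }
      left_triangle := by
        ext X
        exact (congrArg (𝟙 (X.obj star) ≫ ·) (Category.id_comp _)).trans (Category.id_comp _)
      right_triangle := by
        ext X : 2
        refine hom_ext ?_ (fun y => (isZero_extStar_obj_obj_of Y₀ A X y).eq_of_tgt _ _)
        exact (congrArg (𝟙 X ≫ ·) (Category.id_comp _)).trans (Category.id_comp _) }

instance : PreservesFiniteLimits (extStar Y₀ A) := by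
  unfold extStar
  infer_instance

instance : PreservesFiniteColimits (extStar Y₀ A) := by
  unfold extStar
  infer_instance

instance : IsIso (evStarAdj Y₀ A).counit :=
  (NatTrans.isIso_iff_isIso_app _).2 fun X => inferInstanceAs (IsIso (𝟙 X))

section

variable [Finite Y] (hY₀ : ∀ y ∈ Y₀, ∀ y' ∈ Y₀, ∀ z, y ≤ z → y' ≤ z → y = y')

/-- The projection from the product over `Y₀`. -/
noncomputable def prodOverπ (M : Y ⥤ A) (y : Y) (h : ∃ y₀ ∈ Y₀, y₀ ≤ y) : (prodOver Y₀ A).obj M ⟶ M.obj y :=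
  limit.π ((restrDiscrete Y₀ A).obj M) ⟨⟨h.choose, h.choose_spec.1⟩⟩ ≫
    M.map (homOfLE h.choose_spec.2)

variable {Y₀ A}

-- Disjoint up-sets leave at most one element of Y₀ below `y`, so the choice in `prodOverπ` is
-- forced. The elements above `*` thus split into up-sets with least elements in Y₀, and the Kan
-- extension at `*` is a mere product.
include hY₀ in
lemma prodOverπ_eq (M : Y ⥤ A) {y : Y} (h : ∃ y₀ ∈ Y₀, y₀ ≤ y) (y₀ : Y) (hy₀ : y₀ ∈ Y₀)
    (hy : y₀ ≤ y) : prodOverπ Y₀ A M y h =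
      limit.π ((restrDiscrete Y₀ A).obj M) ⟨⟨y₀, hy₀⟩⟩ ≫ M.map (homOfLE hy) := by
  obtain rfl := hY₀ _ hy₀ _ h.choose_spec.1 y hy h.choose_spec.2
  rfl

/-- The right Kan extension to `Y ∪ {*}` of diagrams on `Y`. -/
noncomputable def extRight : (Y ⥤ A) ⥤ (SourceExtension Y₀ ⥤ A) :=
  lift (prodOver Y₀ A) (𝟭 _) (prodOverπ Y₀ A)
    (fun M y y' f h h' => by
      obtain ⟨y₀, hy₀, hy⟩ := id h
      rw [prodOverπ_eq hY₀ M h y₀ hy₀ hy, prodOverπ_eq hY₀ M h' y₀ hy₀ (hy.trans (leOfHom f)),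
        Category.assoc]
      exact congrArg _ (M.map_comp _ _).symm)
    (fun M M' f y h => by
      simp [prodOverπ])

instance : PreservesFiniteLimits (extRight (A := A) hY₀) := by
  unfold extRight
  infer_instance

instance : PreservesFiniteColimits (extRight (A := A) hY₀) := by
  unfold extRight
  infer_instance

variable (Y₀ A) in
/-- The canonical morphism from the value at `*` to the product over `Y₀`. -/
noncomputable def starToProd : evStar Y₀ A ⟶ restr Y₀ A ⋙ prodOver Y₀ A where
  app X := limit.lift ((restrDiscrete Y₀ A).obj ((restr Y₀ A).obj X))
    { pt := X.obj star
      π := Discrete.natTrans fun y₀ => X.map (starHom ⟨y₀.as, y₀.as.2, le_rfl⟩) }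
  naturality X X' f := limit.hom_ext fun y₀ => by
    simp

variable (Y₀ A) in
lemma starToProd_app_π (X : SourceExtension Y₀ ⥤ A) (y₀ : Y₀) :
    (starToProd Y₀ A).app X ≫ limit.π ((restrDiscrete Y₀ A).obj ((restr Y₀ A).obj X)) ⟨y₀⟩ =
      X.map (starHom ⟨y₀, y₀.2, le_rfl⟩) :=
  limit.lift_π _ _

/-- The right Kan extension to `Y ∪ {*}` extends diagrams on `Y`. -/
noncomputable def extRightCompRestrIso : extRight (A := A) hY₀ ⋙ restr Y₀ A ≅ 𝟭 _ :=
  NatIso.ofComponents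
    (fun M => NatIso.ofComponents (fun y => Iso.refl (M.obj y))
      (fun f => (Category.comp_id (M.map f)).trans (Category.id_comp _).symm))
    (fun f => by
      ext y
      exact (Category.comp_id (f.app y)).trans (Category.id_comp _).symm)

lemma starToProd_app_extRight_obj (M : Y ⥤ A) :
    (starToProd Y₀ A).app ((extRight hY₀).obj M) ≫
      (prodOver Y₀ A).map ((extRightCompRestrIso hY₀).hom.app M) = 𝟙 ((prodOver Y₀ A).obj M) := by
  refine limit.hom_ext fun ⟨y₀⟩ => ?_
  have h₁ : (prodOver Y₀ A).map ((extRightCompRestrIso hY₀).hom.app M) ≫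
      limit.π ((restrDiscrete Y₀ A).obj M) ⟨y₀⟩ =
        limit.π ((restrDiscrete Y₀ A).obj ((restr Y₀ A).obj ((extRight hY₀).obj M))) ⟨y₀⟩ ≫
          𝟙 (M.obj y₀) := limMap_π _ _
  have h₂ : ((extRight hY₀).obj M).map (starHom ⟨y₀, y₀.2, le_rfl⟩) =
      limit.π ((restrDiscrete Y₀ A).obj M) ⟨y₀⟩ ≫ M.map (𝟙 _) :=
    prodOverπ_eq hY₀ M _ y₀ y₀.2 le_rfl
  refine (Category.assoc _ _ _).trans ((congrArg (_ ≫ ·) h₁).trans ?_)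
  refine (congrArg (_ ≫ ·) (Category.comp_id _)).trans ?_
  refine (starToProd_app_π Y₀ A ((extRight hY₀).obj M) y₀).trans (h₂.trans ?_)
  rw [M.map_id]
  exact (Category.comp_id _).trans (Category.id_comp _).symm

/-- The right Kan extension to `Y ∪ {*}` is right adjoint to the restriction. -/
noncomputable def restrAdj : restr Y₀ A ⊣ extRight (A := A) hY₀ :=
  Adjunction.mkOfUnitCounit
    { unit :=
        { app := fun X => mkHom ((starToProd Y₀ A).app X) (𝟙 (incl Y₀ ⋙ X)) (fun y h => by
            obtain ⟨y₀, hy₀, hy⟩ := id h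
            refine (Category.comp_id _).trans ?_
            refine Eq.trans ?_ (congrArg (_ ≫ ·) (prodOverπ_eq hY₀ (incl Y₀ ⋙ X) h y₀ hy₀ hy).symm)
            refine Eq.trans ?_ ((Category.assoc _ _ _).symm.trans
              (congrArg (· ≫ X.map _) (starToProd_app_π Y₀ A X ⟨y₀, hy₀⟩))).symm
            exact X.map_comp (starHom ⟨y₀, hy₀, le_rfl⟩) ((incl Y₀).map (homOfLE hy)))
          naturality := fun X X' f => hom_ext
            ((starToProd Y₀ A).naturality f)
            (fun y => (Category.comp_id (f.app (of y))).trans (Category.id_comp _).symm) }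
      counit := (extRightCompRestrIso hY₀).hom
      left_triangle := by
        ext X y
        exact (congrArg (𝟙 (X.obj (of y)) ≫ ·) (Category.id_comp _)).trans (Category.id_comp _)
      right_triangle := by
        ext M : 2
        refine hom_ext (limit.hom_ext fun y₀ => ?_) (fun y => ?_)
        · exact (congrArg (· ≫ limit.π ((restrDiscrete Y₀ A).obj M) y₀)
            ((congrArg ((starToProd Y₀ A).app _ ≫ ·) (Category.id_comp _)).trans
              (starToProd_app_extRight_obj hY₀ M)))
        · exact (congrArg (𝟙 (M.obj y) ≫ ·) (Category.id_comp _)).trans (Category.id_comp _) }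

/-- This makes the cone vanish at `*` on right Kan extensions, so that they go to extensions by
zero. -/
lemma isIso_starToProd_app_extRight_obj (M : Y ⥤ A) :
    IsIso ((starToProd Y₀ A).app ((extRight hY₀).obj M)) :=
  @IsIso.of_isIso_fac_right _ _ _ _ _ _ _ _
    ((prodOver Y₀ A).mapIso ((extRightCompRestrIso hY₀).app M)).isIso_hom (IsIso.id _)
    (starToProd_app_extRight_obj hY₀ M)

instance : IsIso (restrAdj (A := A) hY₀).counit :=
  inferInstanceAs (IsIso (extRightCompRestrIso hY₀).hom)

end

lemma isZero_of_isZero_evStar_obj (X : SourceExtension Y₀ ⥤ A) (h : IsZero ((evStar Y₀ A).obj X))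
    (h' : IsZero ((restr Y₀ A).obj X)) : IsZero X :=
  Functor.isZero _ fun p => by
    rcases p with _ | y
    · exact h
    · exact h'.obj y

end SourceExtension

/-! ### Building diagrams on the poset with an added sink. -/

namespace SinkExtension

variable {Y : Type a} [PartialOrder Y] (Y₀ : Set Y) (A : Type u) [Category.{v} A]

/-- The inclusion of `Y` in `Y ∪ {*}`. -/
def incl : Y ⥤ SinkExtension Y₀ :=
  Monotone.functor (f := SinkExtension.of) (fun _ _ h => h)

/-- The restriction of diagrams to `Y`. -/
abbrev restr : (SinkExtension Y₀ ⥤ A) ⥤ (Y ⥤ A) :=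
  (Functor.whiskeringLeft _ _ A).obj (incl Y₀)

/-- The evaluation at `*`. -/
abbrev evStar : (SinkExtension Y₀ ⥤ A) ⥤ A := (evaluation _ A).obj star

variable {Y₀ A}

/-- The morphism to `*` from an element below an element of `Y₀`. -/
def starHom {y : Y} (h : ∃ y₀ ∈ Y₀, y ≤ y₀) : (incl Y₀).obj y ⟶ (star : SinkExtension Y₀) :=
  homOfLE h

/-- Constructor for diagrams on `Y ∪ {*}`. -/
def mkObj (K : A) (M : Y ⥤ A) (g : ∀ y, (∃ y₀ ∈ Y₀, y ≤ y₀) → (M.obj y ⟶ K))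
    (hg : ∀ ⦃y y'⦄ (f : y ⟶ y') h h', M.map f ≫ g y' h' = g y h) : SinkExtension Y₀ ⥤ A where
  obj
    | star => K
    | of y => M.obj y
  map {p q} f :=
    match p, q, f with
    | star, star, _ => 𝟙 _
    | of y, star, f => g y (leOfHom f)
    | star, of _, f => (leOfHom f : False).elim
    | of y, of y', f => M.map (homOfLE (leOfHom f : y ≤ y'))
  map_id p := by
    cases p
    · rfl
    · exact M.map_id _
  map_comp {p q r} f f' := by
    rcases p with _ | p <;> rcases q with _ | q <;> rcases r with _ | r
    · exact (Category.id_comp _).symm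
    · exact (leOfHom f' : False).elim
    · exact (leOfHom f : False).elim
    · exact (leOfHom f : False).elim
    · exact (Category.comp_id _).symm
    · exact (leOfHom f' : False).elim
    · exact (hg _ _ _).symm
    · exact M.map_comp (homOfLE (leOfHom f : p ≤ q)) (homOfLE (leOfHom f' : q ≤ r))

/-- Constructor for morphisms of diagrams on `Y ∪ {*}`. -/
def mkHom {F G : SinkExtension Y₀ ⥤ A} (φ : F.obj star ⟶ G.obj star)
    (ψ : incl Y₀ ⋙ F ⟶ incl Y₀ ⋙ G)
    (h : ∀ y (h : ∃ y₀ ∈ Y₀, y ≤ y₀), F.map (starHom h) ≫ φ = ψ.app y ≫ G.map (starHom h)) :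
    F ⟶ G where
  app
    | star => φ
    | of y => ψ.app y
  naturality p q f := by
    rcases p with _ | p <;> rcases q with _ | q
    · rw [Subsingleton.elim f (𝟙 _), F.map_id, G.map_id]
      exact (Category.id_comp _).trans (Category.comp_id _).symm
    · exact (leOfHom f : False).elim
    · exact h p (leOfHom f)
    · exact ψ.naturality (homOfLE (leOfHom f : p ≤ q))

lemma hom_ext {F G : SinkExtension Y₀ ⥤ A} {f g : F ⟶ G} (h : f.app star = g.app star)
    (h' : ∀ y, f.app (of y) = g.app (of y)) : f = g := by
  ext p
  cases p
  · exact h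
  · exact h' _

variable {C : Type*} [Category* C]

/-- Constructor for functors to the category of diagrams on `Y ∪ {*}`. -/
def lift (K : C ⥤ A) (M : C ⥤ Y ⥤ A)
    (g : ∀ X y, (∃ y₀ ∈ Y₀, y ≤ y₀) → ((M.obj X).obj y ⟶ K.obj X))
    (hg : ∀ X ⦃y y'⦄ (f : y ⟶ y') h h', (M.obj X).map f ≫ g X y' h' = g X y h)
    (hg' : ∀ ⦃X X'⦄ (f : X ⟶ X') y h, g X y h ≫ K.map f = (M.map f).app y ≫ g X' y h) :
    C ⥤ SinkExtension Y₀ ⥤ A where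
  obj X := mkObj (K.obj X) (M.obj X) (g X) (hg X)
  map {X X'} f := mkHom (F := mkObj (K.obj X) (M.obj X) (g X) (hg X))
    (G := mkObj (K.obj X') (M.obj X') (g X') (hg X')) (K.map f)
    { app := (M.map f).app, naturality := fun _ _ φ => (M.map f).naturality φ } (hg' f)
  map_id X := hom_ext (K.map_id X) (fun y => congr_app (M.map_id X) y)
  map_comp f g := hom_ext (K.map_comp f g) (fun y => congr_app (M.map_comp f g) y)

section

variable [Abelian A] (K : C ⥤ A) (M : C ⥤ Y ⥤ A)
    (g : ∀ X y, (∃ y₀ ∈ Y₀, y ≤ y₀) → ((M.obj X).obj y ⟶ K.obj X)) (hg hg')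

instance preservesFiniteLimits_lift [PreservesFiniteLimits K] [PreservesFiniteLimits M] :
    PreservesFiniteLimits (lift K M g hg hg') := by
  refine preservesFiniteLimits_of_evaluation _ fun p => ?_
  rcases p with _ | y
  · exact inferInstanceAs (PreservesFiniteLimits K)
  · exact inferInstanceAs (PreservesFiniteLimits (M ⋙ (evaluation _ _).obj y))

instance preservesFiniteColimits_lift [PreservesFiniteColimits K] [PreservesFiniteColimits M] :
    PreservesFiniteColimits (lift K M g hg hg') := by
  refine preservesFiniteColimits_of_evaluation _ fun p => ?_
  rcases p with _ | y
  · exact inferInstanceAs (PreservesFiniteColimits K)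
  · exact inferInstanceAs (PreservesFiniteColimits (M ⋙ (evaluation _ _).obj y))

end

end SinkExtension

/-! ### Extensions by zero and left Kan extension for the sink. -/

namespace SinkExtension

variable {Y : Type a} [PartialOrder Y] (Y₀ : Set Y) (A : Type u) [Category.{v} A] [Abelian A]

open ZeroObject

/-- The extension by zero of an object placed at `*`. -/
noncomputable def extStar : A ⥤ (SinkExtension Y₀ ⥤ A) :=
  lift (𝟭 A) (zeroFunctor A (Y ⥤ A)) (fun _ _ _ => 0) (by simp) (by simp)

instance : PreservesFiniteLimits (extStar Y₀ A) := by
  unfold extStar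
  infer_instance

instance : PreservesFiniteColimits (extStar Y₀ A) := by
  unfold extStar
  infer_instance

lemma isZero_extStar_obj_obj_of (X : A) (y : Y) : IsZero (((extStar Y₀ A).obj X).obj (of y)) :=
  ((isZero_zero (Y ⥤ A)).obj y : IsZero ((0 : Y ⥤ A).obj y))

lemma isZero_restr_obj_extStar_obj (X : A) : IsZero ((restr Y₀ A).obj ((extStar Y₀ A).obj X)) :=
  isZero_zero (Y ⥤ A)

/-- The extension by zero from `*` is left adjoint to the evaluation at `*`. -/
noncomputable def evStarAdj : extStar Y₀ A ⊣ evStar Y₀ A :=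
  Adjunction.mkOfUnitCounit
    { unit :=
        { app := fun X => 𝟙 X
          naturality := fun X X' f => (Category.comp_id f).trans (Category.id_comp f).symm }
      counit :=
        { app := fun X => mkHom (F := (extStar Y₀ A).obj (X.obj star)) (𝟙 (X.obj star)) 0
            (fun y _ => (isZero_extStar_obj_obj_of Y₀ A _ y).eq_of_src _ _)
          naturality := fun X X' f => hom_ext
            ((Category.comp_id (f.app star)).trans (Category.id_comp _).symm)
            (fun y => (isZero_extStar_obj_obj_of Y₀ A _ y).eq_of_src _ _) }
      left_triangle := by
        ext X : 2
        refine hom_ext ?_ (fun y => (isZero_extStar_obj_obj_of Y₀ A X y).eq_of_src _ _)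
        exact (congrArg (𝟙 X ≫ ·) (Category.id_comp _)).trans (Category.id_comp _)
      right_triangle := by
        ext X
        exact (congrArg (𝟙 (X.obj star) ≫ ·) (Category.id_comp _)).trans (Category.id_comp _) }

instance : IsIso (evStarAdj Y₀ A).unit :=
  (NatTrans.isIso_iff_isIso_app _).2 fun X => inferInstanceAs (IsIso (𝟙 X))

/-- The extension by zero to `Y ∪ {*}` of diagrams on `Y`. -/
noncomputable def extZero : (Y ⥤ A) ⥤ (SinkExtension Y₀ ⥤ A) :=
  lift (zeroFunctor (Y ⥤ A) A) (𝟭 _) (fun _ _ _ => 0) (by simp) (by simp)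

instance : PreservesFiniteLimits (extZero Y₀ A) := by
  unfold extZero
  infer_instance

instance : PreservesFiniteColimits (extZero Y₀ A) := by
  unfold extZero
  infer_instance

lemma isZero_evStar_obj_extZero_obj (M : Y ⥤ A) :
    IsZero ((evStar Y₀ A).obj ((extZero Y₀ A).obj M)) :=
  isZero_zero A

/-- The extension by zero extends diagrams on `Y`. -/
noncomputable def extZeroCompRestrIso : extZero Y₀ A ⋙ restr Y₀ A ≅ 𝟭 _ :=
  NatIso.ofComponents
    (fun M => NatIso.ofComponents (fun y => Iso.refl (M.obj y))
      (fun f => (Category.comp_id (M.map f)).trans (Category.id_comp _).symm))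
    (fun f => by
      ext y
      exact (Category.comp_id (f.app y)).trans (Category.id_comp _).symm)

/-- The extension by zero is right adjoint to the restriction. -/
noncomputable def restrAdj : restr Y₀ A ⊣ extZero Y₀ A :=
  Adjunction.mkOfUnitCounit
    { unit :=
        { app := fun X => mkHom (G := (extZero Y₀ A).obj (incl Y₀ ⋙ X)) 0 (𝟙 (incl Y₀ ⋙ X))
            (fun _ _ => (isZero_evStar_obj_extZero_obj Y₀ A (incl Y₀ ⋙ X)).eq_of_tgt _ _)
          naturality := fun X X' f => hom_ext
            ((isZero_evStar_obj_extZero_obj Y₀ A (incl Y₀ ⋙ X')).eq_of_tgt _ _)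
            (fun y => (Category.comp_id (f.app (of y))).trans (Category.id_comp _).symm) }
      counit := (extZeroCompRestrIso Y₀ A).hom
      left_triangle := by
        ext X y
        exact (congrArg (𝟙 (X.obj (of y)) ≫ ·) (Category.id_comp _)).trans (Category.id_comp _)
      right_triangle := by
        ext M : 2
        refine hom_ext ((isZero_evStar_obj_extZero_obj Y₀ A M).eq_of_tgt _ _) (fun y => ?_)
        exact (congrArg (𝟙 (M.obj y) ≫ ·) (Category.id_comp _)).trans (Category.id_comp _) }

instance : IsIso (restrAdj Y₀ A).counit :=
  inferInstanceAs (IsIso (extZeroCompRestrIso Y₀ A).hom)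

section

variable [Finite Y] (hY₀ : ∀ y ∈ Y₀, ∀ y' ∈ Y₀, ∀ z, z ≤ y → z ≤ y' → y = y')

/-- The inclusion in the coproduct over `Y₀`. -/
noncomputable def coprodOverι (M : Y ⥤ A) (y : Y) (h : ∃ y₀ ∈ Y₀, y ≤ y₀) :
    M.obj y ⟶ (coprodOver Y₀ A).obj M :=
  M.map (homOfLE h.choose_spec.2) ≫
    colimit.ι ((restrDiscrete Y₀ A).obj M) ⟨⟨h.choose, h.choose_spec.1⟩⟩

variable {Y₀ A}

-- Dually, disjoint down-sets leave at most one element of Y₀ above `y`.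
include hY₀ in
lemma coprodOverι_eq (M : Y ⥤ A) {y : Y} (h : ∃ y₀ ∈ Y₀, y ≤ y₀) (y₀ : Y) (hy₀ : y₀ ∈ Y₀)
    (hy : y ≤ y₀) : coprodOverι Y₀ A M y h =
      M.map (homOfLE hy) ≫ colimit.ι ((restrDiscrete Y₀ A).obj M) ⟨⟨y₀, hy₀⟩⟩ := by
  obtain rfl := hY₀ _ hy₀ _ h.choose_spec.1 y hy h.choose_spec.2
  rfl

/-- The left Kan extension to `Y ∪ {*}` of diagrams on `Y`. -/
noncomputable def extLeft : (Y ⥤ A) ⥤ (SinkExtension Y₀ ⥤ A) :=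
  lift (coprodOver Y₀ A) (𝟭 _) (coprodOverι Y₀ A)
    (fun M y y' f h h' => by
      obtain ⟨y₀, hy₀, hy⟩ := id h'
      rw [coprodOverι_eq hY₀ M h' y₀ hy₀ hy,
        coprodOverι_eq hY₀ M h y₀ hy₀ ((leOfHom f).trans hy), ← Category.assoc]
      exact congrArg (· ≫ _) (M.map_comp _ _).symm)
    (fun M M' f y h => by
      simp [coprodOverι])

instance : PreservesFiniteLimits (extLeft (A := A) hY₀) :=
  preservesFiniteLimits_lift ..

instance : PreservesFiniteColimits (extLeft (A := A) hY₀) :=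
  preservesFiniteColimits_lift ..

variable (Y₀ A) in
/-- The canonical morphism from the coproduct over `Y₀` to the value at `*`. -/
noncomputable def coprodToStar : restr Y₀ A ⋙ coprodOver Y₀ A ⟶ evStar Y₀ A where
  app X := colimit.desc ((restrDiscrete Y₀ A).obj ((restr Y₀ A).obj X))
    { pt := X.obj star
      ι := Discrete.natTrans fun y₀ => X.map (starHom ⟨y₀.as, y₀.as.2, le_rfl⟩) }
  naturality X X' f := colimit.hom_ext fun y₀ => by
    simp

variable (Y₀ A) in
lemma coprodToStar_app_ι (X : SinkExtension Y₀ ⥤ A) (y₀ : Y₀) :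
    colimit.ι ((restrDiscrete Y₀ A).obj ((restr Y₀ A).obj X)) ⟨y₀⟩ ≫ (coprodToStar Y₀ A).app X =
      X.map (starHom ⟨y₀, y₀.2, le_rfl⟩) :=
  colimit.ι_desc _ _

/-- The left Kan extension to `Y ∪ {*}` extends diagrams on `Y`. -/
noncomputable def extLeftCompRestrIso : 𝟭 _ ≅ extLeft (A := A) hY₀ ⋙ restr Y₀ A :=
  NatIso.ofComponents
    (fun M => NatIso.ofComponents (fun y => Iso.refl (M.obj y))
      (fun f => (Category.comp_id (M.map f)).trans (Category.id_comp _).symm))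
    (fun f => by
      ext y
      exact (Category.comp_id (f.app y)).trans (Category.id_comp _).symm)

lemma coprodToStar_app_extLeft_obj (M : Y ⥤ A) :
    (coprodOver Y₀ A).map ((extLeftCompRestrIso hY₀).hom.app M) ≫
      (coprodToStar Y₀ A).app ((extLeft hY₀).obj M) = 𝟙 ((coprodOver Y₀ A).obj M) := by
  refine colimit.hom_ext fun ⟨y₀⟩ => ?_
  have h₁ : colimit.ι ((restrDiscrete Y₀ A).obj M) ⟨y₀⟩ ≫
      (coprodOver Y₀ A).map ((extLeftCompRestrIso hY₀).hom.app M) =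
        𝟙 (M.obj y₀) ≫
          colimit.ι ((restrDiscrete Y₀ A).obj ((restr Y₀ A).obj ((extLeft hY₀).obj M))) ⟨y₀⟩ :=
    ι_colimMap _ _
  have h₂ : ((extLeft hY₀).obj M).map (starHom ⟨y₀, y₀.2, le_rfl⟩) =
      M.map (𝟙 _) ≫ colimit.ι ((restrDiscrete Y₀ A).obj M) ⟨y₀⟩ :=
    coprodOverι_eq hY₀ M _ y₀ y₀.2 le_rfl
  refine (Category.assoc _ _ _).symm.trans ((congrArg (· ≫ _) h₁).trans ?_)
  refine (congrArg (· ≫ _) (Category.id_comp _)).trans ?_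
  refine (coprodToStar_app_ι Y₀ A ((extLeft hY₀).obj M) y₀).trans (h₂.trans ?_)
  rw [M.map_id]
  exact (Category.id_comp _).trans (Category.comp_id _).symm

/-- The left Kan extension to `Y ∪ {*}` is left adjoint to the restriction. -/
noncomputable def extLeftAdj : extLeft (A := A) hY₀ ⊣ restr Y₀ A :=
  Adjunction.mkOfUnitCounit
    { unit := (extLeftCompRestrIso hY₀).hom
      counit :=
        { app := fun X => mkHom (F := (extLeft hY₀).obj (incl Y₀ ⋙ X))
            ((coprodToStar Y₀ A).app X) (𝟙 (incl Y₀ ⋙ X)) (fun y h => by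
            obtain ⟨y₀, hy₀, hy⟩ := id h
            refine Eq.trans ?_ (Category.id_comp _).symm
            refine (congrArg (· ≫ _) (coprodOverι_eq hY₀ (incl Y₀ ⋙ X) h y₀ hy₀ hy)).trans ?_
            refine ((Category.assoc _ _ _).trans
              (congrArg (X.map _ ≫ ·) (coprodToStar_app_ι Y₀ A X ⟨y₀, hy₀⟩))).trans ?_
            exact (X.map_comp ((incl Y₀).map (homOfLE hy)) (starHom ⟨y₀, hy₀, le_rfl⟩)).symm)
          naturality := fun X X' f => hom_ext
            ((coprodToStar Y₀ A).naturality f)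
            (fun y => (Category.comp_id (f.app (of y))).trans (Category.id_comp _).symm) }
      left_triangle := by
        ext M : 2
        refine hom_ext (colimit.hom_ext fun y₀ => ?_) (fun y => ?_)
        · exact (congrArg (colimit.ι ((restrDiscrete Y₀ A).obj M) y₀ ≫ ·)
            ((congrArg ((coprodOver Y₀ A).map _ ≫ ·) (Category.id_comp _)).trans
              (coprodToStar_app_extLeft_obj hY₀ M)))
        · exact (congrArg (𝟙 (M.obj y) ≫ ·) (Category.id_comp _)).trans (Category.id_comp _)
      right_triangle := by
        ext X y
        exact (congrArg (𝟙 (X.obj (of y)) ≫ ·) (Category.id_comp _)).trans (Category.id_comp _) }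

instance : IsIso (extLeftAdj (A := A) hY₀).unit :=
  inferInstanceAs (IsIso (extLeftCompRestrIso hY₀).hom)

end

lemma isZero_of_isZero_evStar_obj (X : SinkExtension Y₀ ⥤ A) (h : IsZero ((evStar Y₀ A).obj X))
    (h' : IsZero ((restr Y₀ A).obj X)) : IsZero X :=
  Functor.isZero _ fun p => by
    rcases p with _ | y
    · exact h
    · exact h'.obj y

end SinkExtension

/-! ### The comparison morphism whose cone is taken. -/

section

variable {Y : Type a} [PartialOrder Y] {Y₀ : Set Y} {A : Type u} [Category.{v} A] [Abelian A]
  [Finite Y] (hY₀ : ∀ y ∈ Y₀, ∀ y' ∈ Y₀, ∀ z, z ≤ y → z ≤ y' → y = y')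

/-- The morphism whose cone defines the equivalence: at `*`, it is the canonical morphism from
the value of a diagram at the source `*` to the product over `Y₀`. -/
noncomputable def starToExtLeft :
    SourceExtension.evStar Y₀ A ⋙ SinkExtension.extStar Y₀ A ⟶
      SourceExtension.restr Y₀ A ⋙ SinkExtension.extLeft hY₀ where
  app X := SinkExtension.mkHom (F := (SinkExtension.extStar Y₀ A).obj (X.obj .star))
    (G := (SinkExtension.extLeft hY₀).obj ((SourceExtension.restr Y₀ A).obj X))
    ((SourceExtension.starToProd Y₀ A).app X ≫ (prodOverIsoCoprodOver Y₀ A).hom.app _) 0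
    (fun y _ => (SinkExtension.isZero_extStar_obj_obj_of Y₀ A _ y).eq_of_src _ _)
  naturality _ _ f := SinkExtension.hom_ext
    ((SourceExtension.starToProd Y₀ A ≫
      Functor.whiskerLeft (SourceExtension.restr Y₀ A) (prodOverIsoCoprodOver Y₀ A).hom).naturality f)
    (fun y => (SinkExtension.isZero_extStar_obj_obj_of Y₀ A _ y).eq_of_src _ _)

lemma isIso_starToExtLeft_app_extRight_obj
    (hY₀' : ∀ y ∈ Y₀, ∀ y' ∈ Y₀, ∀ z, y ≤ z → y' ≤ z → y = y') (M : Y ⥤ A) :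
    IsIso ((SinkExtension.evStar Y₀ A).map
      ((starToExtLeft hY₀).app ((SourceExtension.extRight hY₀').obj M))) :=
  have := SourceExtension.isIso_starToProd_app_extRight_obj hY₀' M
  inferInstanceAs (IsIso ((SourceExtension.starToProd Y₀ A).app _ ≫
    (prodOverIsoCoprodOver Y₀ A).hom.app _))

end

/-! ### Arrows in a category and the adjoints of source and target. -/

namespace ArrowDiagram

variable {C D : Type*} [Category* C] [Category* D]

/-- The functor to the category of arrows given by a natural transformation. -/
abbrev ofNatTrans {K K' : C ⥤ D} (τ : K ⟶ K') : C ⥤ (Fin 2 ⥤ D) :=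
  (ComposableArrows.mk₁ τ).flip

instance preservesFiniteLimits_ofNatTrans [Abelian D] {K K' : C ⥤ D} (τ : K ⟶ K')
    [PreservesFiniteLimits K] [PreservesFiniteLimits K'] : PreservesFiniteLimits (ofNatTrans τ) :=
  preservesFiniteLimits_of_evaluation _ fun p => by
    fin_cases p
    · exact inferInstanceAs (PreservesFiniteLimits K)
    · exact inferInstanceAs (PreservesFiniteLimits K')

instance preservesFiniteColimits_ofNatTrans [Abelian D] {K K' : C ⥤ D} (τ : K ⟶ K')
    [PreservesFiniteColimits K] [PreservesFiniteColimits K'] :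
    PreservesFiniteColimits (ofNatTrans τ) :=
  preservesFiniteColimits_of_evaluation _ fun p => by
    fin_cases p
    · exact inferInstanceAs (PreservesFiniteColimits K)
    · exact inferInstanceAs (PreservesFiniteColimits K')

variable (D)

/-- The source of an arrow. -/
abbrev source : (Fin 2 ⥤ D) ⥤ D := (evaluation _ D).obj 0

/-- The target of an arrow. -/
abbrev target : (Fin 2 ⥤ D) ⥤ D := (evaluation _ D).obj 1

/-- The identity arrows. -/
abbrev diag : D ⥤ (Fin 2 ⥤ D) := ofNatTrans (𝟙 (𝟭 D))

/-- The structure morphism of an arrow. -/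
def hom : source D ⟶ target D := (evaluation _ D).map (homOfLE (Fin.zero_le 1))

/-- Identity arrows are left adjoint to the source. -/
def diagAdj : diag D ⊣ source D :=
  Adjunction.mkOfUnitCounit
    { unit := 𝟙 (𝟭 D)
      counit :=
        -- At the target this counit is the arrow itself, so the cone of the counit, evaluated at
        -- the target, is the cone of the arrow.
        { app := fun X => ComposableArrows.homMk₁ (𝟙 (X.obj 0)) ((hom D).app X) rfl
          naturality := fun X X' f => ComposableArrows.hom_ext₁
            ((Category.comp_id _).trans (Category.id_comp _).symm) ((hom D).naturality f) }
      left_triangle := by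
        ext X : 2
        refine ComposableArrows.hom_ext₁ ?_ ?_
        · exact (Category.id_comp _).trans (Category.comp_id _)
        · exact (Category.id_comp _).trans (Category.comp_id _)
      right_triangle := by
        ext X
        exact (Category.id_comp (𝟙 (X.obj 0) ≫ 𝟙 (X.obj 0))).trans (Category.id_comp _) }

instance : IsIso (diagAdj D).unit := inferInstanceAs (IsIso (𝟙 (𝟭 D)))

/-- Identity arrows are right adjoint to the target. -/
def targetAdj : target D ⊣ diag D :=
  Adjunction.mkOfUnitCounit
    { unit :=
        { app := fun X => ComposableArrows.homMk₁ ((hom D).app X) (𝟙 (X.obj 1)) rfl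
          naturality := fun X X' f => ComposableArrows.hom_ext₁
            ((hom D).naturality f) ((Category.comp_id _).trans (Category.id_comp _).symm) }
      counit := 𝟙 (𝟭 D)
      left_triangle := by
        ext X
        exact (Category.id_comp (𝟙 (X.obj 1) ≫ 𝟙 (X.obj 1))).trans (Category.id_comp _)
      right_triangle := by
        ext X : 2
        refine ComposableArrows.hom_ext₁ ?_ ?_
        · exact (Category.id_comp _).trans (Category.comp_id _)
        · exact (Category.id_comp _).trans (Category.comp_id _) }

instance : IsIso (targetAdj D).counit := inferInstanceAs (IsIso (𝟙 (𝟭 D)))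

variable {D} in
lemma isZero_of_isZero_source_obj (X : Fin 2 ⥤ D) (h : IsZero ((source D).obj X))
    (h' : IsZero ((target D).obj X)) : IsZero X :=
  Functor.isZero _ fun p => by
    fin_cases p
    · exact h
    · exact h'

variable [HasZeroObject D] [HasZeroMorphisms D]

/-- The arrows to zero. -/
noncomputable abbrev toZero : D ⥤ (Fin 2 ⥤ D) := ofNatTrans (0 : 𝟭 D ⟶ zeroFunctor D D)

/-- The arrows from zero. -/
noncomputable abbrev fromZero : D ⥤ (Fin 2 ⥤ D) := ofNatTrans (0 : zeroFunctor D D ⟶ 𝟭 D)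

/-- Arrows to zero are right adjoint to the source. -/
noncomputable def sourceAdj : source D ⊣ toZero D :=
  Adjunction.mkOfUnitCounit
    { unit :=
        { app := fun X => ComposableArrows.homMk₁ (𝟙 (X.obj 0)) 0
            ((isZero_zero D).eq_of_tgt _ _)
          naturality := fun X X' f => ComposableArrows.hom_ext₁
            ((Category.comp_id _).trans (Category.id_comp _).symm)
            ((isZero_zero D).eq_of_tgt _ _) }
      counit := 𝟙 (𝟭 D)
      left_triangle := by
        ext X
        exact (Category.id_comp (𝟙 (X.obj 0) ≫ 𝟙 (X.obj 0))).trans (Category.id_comp _)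
      right_triangle := by
        ext X : 2
        refine ComposableArrows.hom_ext₁ ?_ ((isZero_zero D).eq_of_tgt _ _)
        exact (Category.id_comp _).trans (Category.comp_id _) }

instance : IsIso (sourceAdj D).counit := inferInstanceAs (IsIso (𝟙 (𝟭 D)))

/-- Arrows from zero are left adjoint to the target. -/
noncomputable def fromZeroAdj : fromZero D ⊣ target D :=
  Adjunction.mkOfUnitCounit
    { unit := 𝟙 (𝟭 D)
      counit :=
        { app := fun X => ComposableArrows.homMk₁ (F := (fromZero D).obj (X.obj 1)) (G := X)
            0 (𝟙 (X.obj 1)) ((isZero_zero D).eq_of_src _ _)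
          naturality := fun X X' f => ComposableArrows.hom_ext₁
            ((isZero_zero D).eq_of_src _ _)
            ((Category.comp_id _).trans (Category.id_comp _).symm) }
      left_triangle := by
        ext X : 2
        refine ComposableArrows.hom_ext₁ ((isZero_zero D).eq_of_src _ _) ?_
        exact (Category.id_comp _).trans (Category.comp_id _)
      right_triangle := by
        ext X
        exact (Category.id_comp (𝟙 (X.obj 1) ≫ 𝟙 (X.obj 1))).trans (Category.id_comp _) }

instance : IsIso (fromZeroAdj D).unit := inferInstanceAs (IsIso (𝟙 (𝟭 D)))

end ArrowDiagram

/-! ### Composites of exact functors on derived categories. -/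

section

variable {C C' D E E' : Type*} [Category* C] [Abelian C] [HasDerivedCategory C]
  [Category* C'] [Abelian C'] [HasDerivedCategory C']
  [Category* D] [Abelian D] [HasDerivedCategory D]
  [Category* E] [Abelian E] [HasDerivedCategory E]
  [Category* E'] [Abelian E'] [HasDerivedCategory E']
  {F : C ⥤ D} [F.Additive] [PreservesFiniteLimits F] [PreservesFiniteColimits F]
  {H : D ⥤ E} [H.Additive] [PreservesFiniteLimits H] [PreservesFiniteColimits H]

lemma isZero_mapDerivedCategory_obj_obj (h : ∀ X, IsZero (H.obj (F.obj X)))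
    (X : DerivedCategory C) :
    IsZero (H.mapDerivedCategory.obj (F.mapDerivedCategory.obj X)) :=
  (isZero_mapDerivedCategory_obj (F := F ⋙ H) h X).of_iso
    ((mapDerivedCategoryCompIso (Iso.refl (F ⋙ H))).app X)

/-- Isomorphic composites of exact functors induce isomorphic functors on derived categories. -/
noncomputable def mapDerivedCategorySquareIso
    {F' : C ⥤ C'} [F'.Additive] [PreservesFiniteLimits F'] [PreservesFiniteColimits F']
    {H' : C' ⥤ E} [H'.Additive] [PreservesFiniteLimits H'] [PreservesFiniteColimits H']
    (e : F ⋙ H ≅ F' ⋙ H') :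
    F.mapDerivedCategory ⋙ H.mapDerivedCategory ≅
      F'.mapDerivedCategory ⋙ H'.mapDerivedCategory :=
  mapDerivedCategoryCompIso e ≪≫ (mapDerivedCategoryCompIso (Iso.refl (F' ⋙ H'))).symm

/-- A complex representing `X` is sent by `S` to a complex with terms in the image of `S`, where the
hypothesis applies degreewise. -/
lemma isIso_mapDerivedCategory_map_counit_app_obj
    {G : D ⥤ C} [G.Additive] [PreservesFiniteLimits G] [PreservesFiniteColimits G]
    {S : C' ⥤ D} [S.Additive] [PreservesFiniteLimits S] [PreservesFiniteColimits S]
    (adj : F ⊣ G) (h : ∀ X, IsIso (H.map (adj.counit.app (S.obj X)))) (X : DerivedCategory C') :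
    IsIso (H.mapDerivedCategory.map
      (adj.mapDerivedCategory.counit.app (S.mapDerivedCategory.obj X))) := by
  let K := DerivedCategory.Q.objPreimage X
  refine (NatTrans.isIso_app_iff_of_iso
    (Functor.whiskerRight adj.mapDerivedCategory.counit H.mapDerivedCategory)
    (S.mapDerivedCategory.mapIso (DerivedCategory.Q.objObjPreimageIso X).symm ≪≫
      S.mapDerivedCategoryFactors.app K)).2 ?_
  exact isIso_mapDerivedCategory_map_counit_app adj fun n => h _

lemma isIso_mapDerivedCategory_map_map_counit_app_obj_obj
    {G : D ⥤ C} [G.Additive] [PreservesFiniteLimits G] [PreservesFiniteColimits G]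
    {B : Type*} [Category* B] [Abelian B] [HasDerivedCategory B]
    {T : B ⥤ C'} [T.Additive] [PreservesFiniteLimits T] [PreservesFiniteColimits T]
    {S : C' ⥤ D} [S.Additive] [PreservesFiniteLimits S] [PreservesFiniteColimits S]
    {H' : E ⥤ E'} [H'.Additive] [PreservesFiniteLimits H'] [PreservesFiniteColimits H']
    (adj : F ⊣ G) (h : ∀ X, IsIso (H'.map (H.map (adj.counit.app (S.obj (T.obj X))))))
    (X : DerivedCategory B) :
    IsIso (H'.mapDerivedCategory.map (H.mapDerivedCategory.map
      (adj.mapDerivedCategory.counit.app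
        (S.mapDerivedCategory.obj (T.mapDerivedCategory.obj X))))) := by
  refine (NatIso.isIso_map_iff (mapDerivedCategoryCompIso (Iso.refl (H ⋙ H'))) _).2 ?_
  refine (NatTrans.isIso_app_iff_of_iso
    (Functor.whiskerRight adj.mapDerivedCategory.counit (H ⋙ H').mapDerivedCategory)
    ((mapDerivedCategoryCompIso (Iso.refl (T ⋙ S))).app X)).2 ?_
  exact isIso_mapDerivedCategory_map_counit_app_obj adj h X

end

theorem corollaryc {Y : Type a} [PartialOrder Y] [Finite Y] (Y₀ : Set Y)
    (hY₀ : ∀ y ∈ Y₀, ∀ y' ∈ Y₀, y ≠ y' →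
      Set.Ici y ∩ Set.Ici y' = ∅ ∧ Set.Iic y ∩ Set.Iic y' = ∅) :
    UniversallyDerivedEquivalent.{v, u, w₁, w₂} (SourceExtension Y₀) (SinkExtension Y₀) := by
  intro A _ _ _ _
  have hY₁ : ∀ y ∈ Y₀, ∀ y' ∈ Y₀, ∀ z, y ≤ z → y' ≤ z → y = y' := fun y hy y' hy' z h h' =>
    by_contra fun hne => (Set.eq_empty_iff_forall_notMem.1 (hY₀ y hy y' hy' hne).1) z ⟨h, h'⟩
  have hY₂ : ∀ y ∈ Y₀, ∀ y' ∈ Y₀, ∀ z, z ≤ y → z ≤ y' → y = y' := fun y hy y' hy' z h h' =>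
    by_contra fun hne => (Set.eq_empty_iff_forall_notMem.1 (hY₀ y hy y' hy' hne).2) z ⟨h, h'⟩
  -- These three derived categories are auxiliary and absent from the conclusion, so any
  -- localization serves.
  let _ := HasDerivedCategory.standard A
  let _ := HasDerivedCategory.standard (Y ⥤ A)
  let _ := HasDerivedCategory.standard (Fin 2 ⥤ SinkExtension Y₀ ⥤ A)
  let E := ArrowDiagram.ofNatTrans (starToExtLeft (A := A) hY₂)
  have := additive_of_preservesFiniteLimits (SourceExtension.restr Y₀ A)
  have := additive_of_preservesFiniteLimits (SourceExtension.evStar Y₀ A)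
  have := additive_of_preservesFiniteLimits (SourceExtension.extStar Y₀ A)
  have := additive_of_preservesFiniteLimits (SourceExtension.extRight (A := A) hY₁)
  have := additive_of_preservesFiniteLimits (SinkExtension.restr Y₀ A)
  have := additive_of_preservesFiniteLimits (SinkExtension.evStar Y₀ A)
  have := additive_of_preservesFiniteLimits (SinkExtension.extStar Y₀ A)
  have := additive_of_preservesFiniteLimits (SinkExtension.extZero Y₀ A)
  have := additive_of_preservesFiniteLimits (SinkExtension.extLeft (A := A) hY₂)
  have := additive_of_preservesFiniteLimits (ArrowDiagram.source (SinkExtension Y₀ ⥤ A))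
  have := additive_of_preservesFiniteLimits (ArrowDiagram.target (SinkExtension Y₀ ⥤ A))
  have := additive_of_preservesFiniteLimits (ArrowDiagram.diag (SinkExtension Y₀ ⥤ A))
  have := additive_of_preservesFiniteLimits (ArrowDiagram.toZero (SinkExtension Y₀ ⥤ A))
  have := additive_of_preservesFiniteLimits (ArrowDiagram.fromZero (SinkExtension Y₀ ⥤ A))
  have := additive_of_preservesFiniteLimits E
  have := isIso_mapDerivedCategory_counit (SourceExtension.restrAdj (A := A) hY₁)
  have := isIso_mapDerivedCategory_counit (SourceExtension.evStarAdj Y₀ A)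
  have := isIso_mapDerivedCategory_counit (SinkExtension.restrAdj Y₀ A)
  have := isIso_mapDerivedCategory_unit (SinkExtension.evStarAdj Y₀ A)
  have := isIso_mapDerivedCategory_unit (SinkExtension.extLeftAdj (A := A) hY₂)
  have := isIso_mapDerivedCategory_unit (ArrowDiagram.diagAdj (SinkExtension Y₀ ⥤ A))
  have := isIso_mapDerivedCategory_counit (ArrowDiagram.targetAdj (SinkExtension Y₀ ⥤ A))
  have := isIso_mapDerivedCategory_unit (ArrowDiagram.fromZeroAdj (SinkExtension Y₀ ⥤ A))
  have := isIso_mapDerivedCategory_counit (ArrowDiagram.sourceAdj (SinkExtension Y₀ ⥤ A))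
  exact exists_triangulated_equivalence_of_gluing
    (SourceExtension.restrAdj (A := A) hY₁).mapDerivedCategory
    (SourceExtension.evStarAdj Y₀ A).mapDerivedCategory
    (isZero_mapDerivedCategory_obj_obj (SourceExtension.isZero_restr_obj_extStar_obj Y₀ A))
    (isZero_of_isZero_mapDerivedCategory_obj (SourceExtension.isZero_of_isZero_evStar_obj Y₀ A))
    (SinkExtension.restrAdj Y₀ A).mapDerivedCategory
    (SinkExtension.evStarAdj Y₀ A).mapDerivedCategory
    (SinkExtension.extLeftAdj (A := A) hY₂).mapDerivedCategory
    (isZero_mapDerivedCategory_obj_obj (SinkExtension.isZero_restr_obj_extStar_obj Y₀ A))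
    (isZero_mapDerivedCategory_obj_obj (SinkExtension.isZero_evStar_obj_extZero_obj Y₀ A))
    (isZero_of_isZero_mapDerivedCategory_obj (SinkExtension.isZero_of_isZero_evStar_obj Y₀ A))
    (ArrowDiagram.diagAdj (SinkExtension Y₀ ⥤ A)).mapDerivedCategory
    (ArrowDiagram.targetAdj (SinkExtension Y₀ ⥤ A)).mapDerivedCategory
    (ArrowDiagram.fromZeroAdj (SinkExtension Y₀ ⥤ A)).mapDerivedCategory
    (ArrowDiagram.sourceAdj (SinkExtension Y₀ ⥤ A)).mapDerivedCategory
    (isZero_mapDerivedCategory_obj_obj fun _ => isZero_zero (SinkExtension Y₀ ⥤ A))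
    (isZero_mapDerivedCategory_obj_obj fun _ => isZero_zero (SinkExtension Y₀ ⥤ A))
    (isZero_of_isZero_mapDerivedCategory_obj ArrowDiagram.isZero_of_isZero_source_obj)
    -- The source and target of `E` are the required composites by definition, already at the level
    -- of diagrams.
    (mapDerivedCategorySquareIso (F := E) (Iso.refl _))
    (mapDerivedCategorySquareIso (F := E) (Iso.refl _))
    (isIso_mapDerivedCategory_map_map_counit_app_obj_obj (S := E) _
      (isIso_starToExtLeft_app_extRight_obj hY₂ hY₁))
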